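/- \textbf{Gauge group.} Let $G$ be a finite-dimensional real Lie group with Lie algebra $\mathfrak g$. Define $\mathrm{Ad}^*(g)$ by $\langle \mathrm{Ad}^*(g)j,\xi\rangle=\langle j,\mathrm{Ad}(g)\xi\rangle$. Let $H=G\ltimes\mathfrak g^*$ with $(u_1,a_1)(u_2,a_2)=(u_1u_2,\,a_1+\mathrm{Ad}^*(u_1^{-1})a_2)$. On $\mathfrak g\oplus\mathfrak g^*=\mathrm{Lie}(H)$ use the pairing $\langle(\mu,s),(\xi,j)\rangle=\langle j,\mu\rangle+\langle s,\xi\rangle$. Every $X\in H$ is written $X=(u_X,-\mathrm{Ad}^*(u_X^{-1})j_X)$. Let $\mathfrak c\subset\mathfrak g\oplus\mathfrak g^*$ be an abelian Lie subalgebra (for instance an abelian Cartan subalgebra), let $k\in\mathbb R$, and fix elements $(\mu_i,s_i)\in\mathfrak g\oplus\mathfrak g^*$, $1\le i\le n$. \textbf{Extended phase space and two-form.} The variables are $g_{M_i}=(v_{M_i},x_{M_i})\in H$ ($1\le i\le n$), $A_j,B_j\in H$ ($1\le j\le g$), $g_\infty=(v_\infty,x_\infty)\in H$, $w\in H$ and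 $(\mu,s)\in\mathfrak c$. Put $M_i=g_{M_i}(e^{-\mu_i},-s_i)g_{M_i}^{-1}$ and $K^{-1}=[B_g,A_g^{-1}]\cdots[B_1,A_1^{-1}]M_n\cdots M_1=(u_K,-\mathrm{Ad}^*(u_K^{-1})j_K)$, where $[X,Y]=XYX^{-1}Y^{-1}$. The variables are subject to the constraint $K^{-1}=g_\infty(e^{-\mu},-s)g_\infty^{-1}$. Let $\delta$ denote the exterior derivative and write $R(u)=\delta u\,u^{-1}$ for $G$-valued $u$. Put $P_i=u_{M_i}\cdots u_{M_1}$ and $Q_i=u_{H_i}\cdots u_{H_1}P_n$ with $u_{H_j}=[u_{B_j},u_{A_j}^{-1}]$. The two-form is $$\Omega=\frac{k}{2\pi}\,\delta\Big(\langle(\mu,s),w^{-1}\delta w\rangle+\Theta+\langle j_K,R(v_\infty)\rangle-\langle \mathrm{Ad}^*(v_\infty)x_\infty-\tfrac12 s,\,\delta\mu\rangle\Big),$$ $$\begin{aligned}\Theta=&\sum_{i=1}^n\langle R(P_{i-1})-R(v_{M_i}),\,j_{M_i}\rangle+\sum_{i=1}^g\langle R(Q_{i-1})-R(u_{A_i}^{-1}u_{B_i}^{-1}u_{A_i}Q_{i-1}),\,j_{A_i}\rangle\\&+\sum_{i=1}^g\langle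 R(u_{A_i}^{-1}u_{B_i}^{-1}u_{A_i}Q_{i-1})-R(u_{B_i}^{-1}u_{A_i}Q_{i-1}),\,j_{B_i}\rangle.\end{aligned}$$ \textbf{Fields and their coordinates.} Let $S$ be a surface of genus $g$ with $n$ ordinary punctures and one distinguished puncture. Next to each puncture fix a reference point $q_i$ (respectively $q_\infty$) and the class $\kappa_i\in\pi_1(S,q_i)$ (respectively $\kappa_\infty\in\pi_1(S,q_\infty)$) of a loop around the puncture. A field consists of a flat $H$-connection on $S$, given by its parallel transports $PT$, together with $w\in H$, $(\mu,s)\in\mathfrak c$ and frames $h_i,h_\infty\in H$ at the points $q_i,q_\infty$, such that the holonomy of $\kappa_i$ is $h_i(e^{-\mu_i},-s_i)h_i^{-1}$ and the inverse of the holonomy of $\kappa_\infty$ is $h_\infty(e^{-\mu},-s)h_\infty^{-1}$. Let $p_0\in S$, and let $a_j,b_j$ ($1\le j\le g$), $m_i$ ($1\le i\le n$), $l_\infty$ generate $\pi_1(S,p_0)$, where $m_i$ (respectively $l_\infty$) runs along a path $e_i$ (respectively $e_\infty$) from $p_0$ to the reference point, then through $\kappa_i$ (respectively $\kappa_\infty$),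 and back along the same path, and $$l_\infty[b_g,a_g^{-1}]\cdots[b_1,a_1^{-1}]m_n\cdots m_1=1$$ (in a product the right factor is traversed first). With these generators a field has coordinates in the extended phase space: $A_j,B_j$ are the holonomies of $a_j,b_j$; $g_{M_i}=PT(e_i)^{-1}h_i$ and $g_\infty=PT(e_\infty)^{-1}h_\infty$, so that $M_i$ is the holonomy of $m_i$ and $K^{-1}=g_\infty(e^{-\mu},-s)g_\infty^{-1}$ is the inverse of the holonomy of $l_\infty$; and $w,(\mu,s)$ are those of the field. \textbf{Statement.} The two-form $\Omega$ does not depend on the choice of the basepoint. That is, let $p_0'\in S$ be another basepoint and $c$ a path from $p_0$ to $p_0'$, and take as generators of $\pi_1(S,p_0')$ the images of $a_j,b_j,m_i,l_\infty$ under the isomorphism $\pi_1(S,p_0)\cong\pi_1(S,p_0')$ induced by $c$ (with $e_i,e_\infty$ replaced by $c^{-1}$ followed by $e_i,e_\infty$). Then, for every family of fields depending smoothly on a parameter in an open subset $U$ of a real normed space (all parallel transports, $h_i$, $h_\infty$, $w$ and $(\mu,s)$ depend smoothly on the parameter), the two-forms on $U$ obtained by evaluating the formula for $\Omega$ on the coordinates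 defined with the basepoint $p_0$ and on the coordinates defined with the basepoint $p_0'$ are equal. -/

import Mathlib

open scoped Manifold ContDiff commutatorElement
open CategoryTheory

namespace ChernSimons

noncomputable section

/-! ## The gauge group `G ⋉ 𝔤*`

`G` is a real Lie group modelled on the finite-dimensional space `E`. In Mathlib the tangent space
`𝔤 = T₁G` (`GroupLieAlgebra 𝓘(ℝ, E) G`) has `E` as its underlying vector space, so elements of
`𝔤` are written as elements of `E`, and elements of `𝔤*` as elements of `StrongDual ℝ E`. -/

section GaugeGroup

variable {E : Type*} [NormedAddCommGroup E] [NormedSpace ℝ E]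
  {G : Type*} [TopologicalSpace G] [ChartedSpace E G] [Group G]

/-- The adjoint action `Ad(g) : 𝔤 → 𝔤`, the derivative at `1` of conjugation by `g`. -/
def Ad (g : G) : E →L[ℝ] E :=
  mfderiv 𝓘(ℝ, E) 𝓘(ℝ, E) (fun x : G => g * x * g⁻¹) 1

/-- `Ad*(g)`, the algebraic dual of `Ad(g)`: `⟨Ad*(g) j, ξ⟩ = ⟨j, Ad(g) ξ⟩`. -/
def AdStar (g : G) (j : StrongDual ℝ E) : StrongDual ℝ E := j.comp (Ad g)

/-- The Lie bracket of `𝔤 = T₁G`. -/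
def lieBracket (G : Type*) [TopologicalSpace G] [ChartedSpace E G] [Group G] (ξ η : E) : E :=
  (⁅(show GroupLieAlgebra 𝓘(ℝ, E) G from ξ), (show GroupLieAlgebra 𝓘(ℝ, E) G from η)⁆ :
    GroupLieAlgebra 𝓘(ℝ, E) G)

/-- A linear subspace `𝔠` of `𝔤 ⊕ 𝔤*` is an abelian Lie subalgebra if all brackets
`[(ξ, j), (η, k)] = ([ξ, η], j ∘ ad η - k ∘ ad ξ)` of its elements vanish. -/
def IsAbelianSubalgebra (G : Type*) [TopologicalSpace G] [ChartedSpace E G] [Group G]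
    (𝔠 : Submodule ℝ (E × StrongDual ℝ E)) : Prop :=
  ∀ X ∈ 𝔠, ∀ Y ∈ 𝔠, lieBracket G X.1 Y.1 = 0 ∧
    ∀ ζ : E, X.2 (lieBracket G Y.1 ζ) - Y.2 (lieBracket G X.1 ζ) = 0

/-- `φ` is the one-parameter subgroup of `G` with initial velocity `ξ`. -/
structure IsOneParameterSubgroup (φ : ℝ → G) (ξ : E) : Prop where
  map_add : ∀ s t : ℝ, φ (s + t) = φ s * φ t
  smooth : ContMDiff 𝓘(ℝ, ℝ) 𝓘(ℝ, E) ∞ φ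
  velocity : (mfderiv 𝓘(ℝ, ℝ) 𝓘(ℝ, E) φ 0 (1 : ℝ) : E) = ξ

open scoped Classical in
/-- The exponential map `e^ξ` of `G`: the value at time `1` of the one-parameter subgroup with
initial velocity `ξ`. -/
def lieExp (G : Type*) [TopologicalSpace G] [ChartedSpace E G] [Group G] (ξ : E) : G :=
  if h : ∃ φ : ℝ → G, IsOneParameterSubgroup φ ξ then h.choose 1 else 1

theorem Ad_one : Ad (1 : G) = ContinuousLinearMap.id ℝ E := by
  have h : (fun x : G => (1 : G) * x * (1 : G)⁻¹) = id := by ext x; simp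
  unfold Ad
  rw [h]
  exact mfderiv_id

theorem AdStar_one (j : StrongDual ℝ E) : AdStar (1 : G) j = j := by
  ext ξ; simp [AdStar, Ad_one]

variable [LieGroup 𝓘(ℝ, E) ∞ G]

theorem Ad_mul (g h : G) : Ad (g * h) = (Ad g).comp (Ad h : E →L[ℝ] E) := by
  have smooth_conj : ∀ (a x : G), MDifferentiableAt 𝓘(ℝ, E) 𝓘(ℝ, E)
      (fun x : G => a * x * a⁻¹) x := fun a x =>
    (((contMDiff_mul_right (I := 𝓘(ℝ, E)) (n := ∞) (a := a⁻¹)).comp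
      (contMDiff_mul_left (I := 𝓘(ℝ, E)) (n := ∞) (a := a))).contMDiffAt).mdifferentiableAt
      (by simp)
  have key := mfderiv_comp (I := 𝓘(ℝ, E)) (I' := 𝓘(ℝ, E)) (I'' := 𝓘(ℝ, E)) (1 : G)
    (g := fun x : G => g * x * g⁻¹) (f := fun x : G => h * x * h⁻¹)
    (smooth_conj g _) (smooth_conj h _)
  have hc : (fun x : G => g * x * g⁻¹) ∘ (fun x : G => h * x * h⁻¹) =
      fun x : G => g * h * x * (g * h)⁻¹ := by
    ext x; simp [mul_assoc]
  have h1 : h * 1 * h⁻¹ = 1 := by simp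
  rw [hc, h1] at key
  exact key

theorem AdStar_mul (g h : G) (j : StrongDual ℝ E) :
    AdStar (g * h) j = AdStar h (AdStar g j) := by
  ext ξ; simp [AdStar, Ad_mul]

/-- The action of `G` on the abelian group `𝔤*` (written multiplicatively) by `g ↦ Ad*(g⁻¹)`. -/
def coadjointAction (E : Type*) [NormedAddCommGroup E] [NormedSpace ℝ E]
    (G : Type*) [TopologicalSpace G] [ChartedSpace E G] [Group G] [LieGroup 𝓘(ℝ, E) ∞ G] :
    G →* MulAut (Multiplicative (StrongDual ℝ E)) where
  toFun g :=
    { toFun := fun a => Multiplicative.ofAdd (AdStar g⁻¹ a.toAdd)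
      invFun := fun a => Multiplicative.ofAdd (AdStar g a.toAdd)
      left_inv := fun a => by
        simp [← AdStar_mul, AdStar_one]
      right_inv := fun a => by
        simp [← AdStar_mul, AdStar_one]
      map_mul' := fun a b => by
        rw [← ofAdd_add]
        congr 1 }
  map_one' := by
    ext a : 1
    change Multiplicative.ofAdd (AdStar (1 : G)⁻¹ a.toAdd) = a
    rw [inv_one, AdStar_one, ofAdd_toAdd]
  map_mul' g h := by
    ext a : 1
    change Multiplicative.ofAdd (AdStar (g * h)⁻¹ a.toAdd) =
      Multiplicative.ofAdd (AdStar g⁻¹ (AdStar h⁻¹ a.toAdd))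
    rw [mul_inv_rev, AdStar_mul]

/-- The gauge group `G ⋉ 𝔤*`, with `(u₁, a₁) (u₂, a₂) = (u₁ u₂, a₁ + Ad*(u₁⁻¹) a₂)`. -/
abbrev GaugeGroup (E : Type*) [NormedAddCommGroup E] [NormedSpace ℝ E]
    (G : Type*) [TopologicalSpace G] [ChartedSpace E G] [Group G] [LieGroup 𝓘(ℝ, E) ∞ G] :=
  Multiplicative (StrongDual ℝ E) ⋊[coadjointAction E G] G

/-- The element `(u, a)` of `G ⋉ 𝔤*`. -/
def pair (u : G) (a : StrongDual ℝ E) : GaugeGroup E G := ⟨Multiplicative.ofAdd a, u⟩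

/-- The component `u ∈ G` of `h = (u, a)`. -/
def grp (h : GaugeGroup E G) : G := h.right

/-- The component `a ∈ 𝔤*` of `h = (u, a)`. -/
def vec (h : GaugeGroup E G) : StrongDual ℝ E := h.left.toAdd

/-- The element `j ∈ 𝔤*` for which `h = (u, -Ad*(u⁻¹) j)`. -/
def jPart (h : GaugeGroup E G) : StrongDual ℝ E := -AdStar (grp h) (vec h)

theorem pair_mul_pair (u₁ u₂ : G) (a₁ a₂ : StrongDual ℝ E) :
    pair u₁ a₁ * pair u₂ a₂ = pair (u₁ * u₂) (a₁ + AdStar u₁⁻¹ a₂) := rfl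

theorem eq_pair_jPart (h : GaugeGroup E G) :
    h = pair (grp h) (-AdStar (grp h)⁻¹ (jPart h)) := by
  have e : AdStar (grp h)⁻¹ (jPart h) = -vec h := by
    have : AdStar (grp h)⁻¹ (jPart h) = -AdStar (grp h)⁻¹ (AdStar (grp h) (vec h)) := by
      ext ξ; simp [jPart, AdStar]
    rw [this, ← AdStar_mul, mul_inv_cancel, AdStar_one]
  rw [e, neg_neg]
  rfl

end GaugeGroup

/-- The ordered product `f (i - 1) * ⋯ * f 1 * f 0` of the first `i` members of a finite family. -/
def descProd {M : Type*} [Monoid M] {n : ℕ} (f : Fin n → M) (i : ℕ) : M :=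
  ((List.ofFn f).take i).reverse.prod

/-! ## Calculus for families of group elements

Differential forms on spaces of fields are evaluated on smooth families, i.e. on maps from an open
subset of a real normed space `V`; then `δ` is the exterior derivative on `V`. -/

section LogDeriv

variable {E : Type*} [NormedAddCommGroup E] [NormedSpace ℝ E]
  {G : Type*} [TopologicalSpace G] [ChartedSpace E G] [Group G]
  {V : Type*} [NormedAddCommGroup V] [NormedSpace ℝ V]

/-- The `𝔤`-valued one-form `δu u⁻¹` of a family `u` of elements of `G`. -/
def rightLogDeriv (u : V → G) (x : V) : V →L[ℝ] E :=
  mfderiv 𝓘(ℝ, V) 𝓘(ℝ, E) (fun y => u y * (u x)⁻¹) x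

variable [LieGroup 𝓘(ℝ, E) ∞ G]

/-- The `𝔤`-component of the one-form `w⁻¹ δw` of a family `w` of elements of `G ⋉ 𝔤*`. -/
def leftLogDerivGrp (w : V → GaugeGroup E G) (x : V) : V →L[ℝ] E :=
  mfderiv 𝓘(ℝ, V) 𝓘(ℝ, E) (fun y => grp ((w x)⁻¹ * w y)) x

/-- The `𝔤*`-component of the one-form `w⁻¹ δw` of a family `w` of elements of `G ⋉ 𝔤*`. -/
def leftLogDerivVec (w : V → GaugeGroup E G) (x : V) : V →L[ℝ] StrongDual ℝ E :=
  fderiv ℝ (fun y => vec ((w x)⁻¹ * w y)) x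

/-- Smoothness on `U` of a family of elements of `G ⋉ 𝔤*`, as a manifold equal to `G × 𝔤*`. -/
def SmoothOn (h : V → GaugeGroup E G) (U : Set V) : Prop :=
  ContMDiffOn 𝓘(ℝ, V) 𝓘(ℝ, E) ∞ (fun x => grp (h x)) U ∧ ContDiffOn ℝ ∞ (fun x => vec (h x)) U

end LogDeriv

/-! ## The extended phase space and its two-form -/

section PhaseSpace

variable (E : Type*) [NormedAddCommGroup E] [NormedSpace ℝ E]
  (G : Type*) [TopologicalSpace G] [ChartedSpace E G] [Group G] [LieGroup 𝓘(ℝ, E) ∞ G]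

/-- The variables of the extended phase space: `gM i = (v_{M_i}, x_{M_i})`, `A j`, `B j`,
`gInf = (v_∞, x_∞)`, `w`, and `μs = (μ, s) ∈ 𝔠`. -/
structure PhasePoint (n g : ℕ) (𝔠 : Submodule ℝ (E × StrongDual ℝ E)) where
  gM : Fin n → GaugeGroup E G
  A : Fin g → GaugeGroup E G
  B : Fin g → GaugeGroup E G
  gInf : GaugeGroup E G
  w : GaugeGroup E G
  μs : 𝔠

variable {E G}

/-- The element `(e^{-μ}, -s)` of `G ⋉ 𝔤*`. -/
def expNeg (X : E × StrongDual ℝ E) : GaugeGroup E G := pair (lieExp G (-X.1)) (-X.2)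

namespace PhasePoint

variable {n g : ℕ} {𝔠 : Submodule ℝ (E × StrongDual ℝ E)}

/-- The holonomy `M_i = (v_{M_i}, x_{M_i}) (e^{-μ_i}, -s_i) (v_{M_i}, x_{M_i})⁻¹` around the `i`-th
ordinary puncture, where `orb i = (μ_i, s_i)` is fixed. -/
def M (orb : Fin n → E × StrongDual ℝ E) (z : PhasePoint E G n g 𝔠) (i : Fin n) :
    GaugeGroup E G :=
  z.gM i * expNeg (orb i) * (z.gM i)⁻¹

/-- `K_{n+2g}⁻¹ = [B_g, A_g⁻¹] ⋯ [B_1, A_1⁻¹] M_n ⋯ M_1`. -/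
def KInv (orb : Fin n → E × StrongDual ℝ E) (z : PhasePoint E G n g 𝔠) : GaugeGroup E G :=
  descProd (fun j => ⁅z.B j, (z.A j)⁻¹⁆) g * descProd (z.M orb) n

/-- The constraint `K_{n+2g}⁻¹ = (v_∞, x_∞) (e^{-μ}, -s) (v_∞, x_∞)⁻¹` on the extended phase
space. -/
def OnConstraintSurface (orb : Fin n → E × StrongDual ℝ E) (z : PhasePoint E G n g 𝔠) : Prop :=
  z.KInv orb = z.gInf * expNeg (z.μs : E × StrongDual ℝ E) * z.gInf⁻¹

/-- The product `u_{M_i} ⋯ u_{M_1}` of the `G`-components of the first `i` holonomies `M`. -/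
def uM (orb : Fin n → E × StrongDual ℝ E) (z : PhasePoint E G n g 𝔠) (i : ℕ) : G :=
  descProd (fun l => grp (z.M orb l)) i

/-- The product `u_{H_i} ⋯ u_{H_1} u_{M_n} ⋯ u_{M_1}`, where `u_{H_j} = [u_{B_j}, u_{A_j}⁻¹]`. -/
def uHM (orb : Fin n → E × StrongDual ℝ E) (z : PhasePoint E G n g 𝔠) (i : ℕ) : G :=
  descProd (fun j => ⁅grp (z.B j), (grp (z.A j))⁻¹⁆) i * z.uM orb n

end PhasePoint

open PhasePoint

variable {n g : ℕ} {𝔠 : Submodule ℝ (E × StrongDual ℝ E)}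
  {V : Type*} [NormedAddCommGroup V] [NormedSpace ℝ V]

/-- The one-form `Θ`, pulled back along the family `F` of points of the extended phase space. The
index `i` starts at `0`, so `u_{M_{i-1}} ⋯ u_{M_1}` becomes `uM orb i`, and likewise for `uHM`. -/
def Theta (orb : Fin n → E × StrongDual ℝ E) (F : V → PhasePoint E G n g 𝔠) (x : V) :
    V →L[ℝ] ℝ :=
  (∑ i : Fin n, (jPart ((F x).M orb i)).comp
      (rightLogDeriv (fun y => (F y).uM orb i) x - rightLogDeriv (fun y => grp ((F y).gM i)) x))
  + (∑ i : Fin g, (jPart ((F x).A i)).comp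
      (rightLogDeriv (fun y => (F y).uHM orb i) x
        - rightLogDeriv (fun y => (grp ((F y).A i))⁻¹ * (grp ((F y).B i))⁻¹ * grp ((F y).A i)
            * (F y).uHM orb i) x))
  + ∑ i : Fin g, (jPart ((F x).B i)).comp
      (rightLogDeriv (fun y => (grp ((F y).A i))⁻¹ * (grp ((F y).B i))⁻¹ * grp ((F y).A i)
            * (F y).uHM orb i) x
        - rightLogDeriv (fun y => (grp ((F y).B i))⁻¹ * grp ((F y).A i) * (F y).uHM orb i) x)

/-- The one-form
`⟨(μ, s), w⁻¹ δw⟩ + Θ + ⟨j_{K_{n+2g}}, δv_∞ v_∞⁻¹⟩ - ⟨Ad*(v_∞) x_∞ - s/2, δμ⟩`,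
pulled back along the family `F` of points of the extended phase space. Here
`⟨(μ, s), (ξ, j)⟩ = ⟨j, μ⟩ + ⟨s, ξ⟩`. -/
def potential (orb : Fin n → E × StrongDual ℝ E) (F : V → PhasePoint E G n g 𝔠) (x : V) :
    V →L[ℝ] ℝ :=
  ((leftLogDerivVec (fun y => (F y).w) x).flip (F x).μs.1.1
    + (F x).μs.1.2.comp (leftLogDerivGrp (fun y => (F y).w) x))
  + Theta orb F x
  + (jPart ((F x).KInv orb)).comp (rightLogDeriv (fun y => grp (F y).gInf) x)
  - (AdStar (grp (F x).gInf) (vec (F x).gInf) - (1 / 2 : ℝ) • (F x).μs.1.2).comp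
      (fderiv ℝ (fun y => (F y).μs.1.1) x)

/-- The two-form `Ω`, equal to `k / 2π` times the exterior derivative of `potential`, pulled back
along the family `F` of points of the extended phase space. -/
def twoForm (k : ℝ) (orb : Fin n → E × StrongDual ℝ E) (F : V → PhasePoint E G n g 𝔠) (x : V) :
    V [⋀^Fin 2]→L[ℝ] ℝ :=
  (k / (2 * Real.pi)) •
    extDeriv (fun y => ContinuousAlternatingMap.ofSubsingleton ℝ V ℝ (0 : Fin 1)
      (potential orb F y)) x

end PhaseSpace

/-! ## Generators of the fundamental group -/

section Surface

/-- Peripheral data of a surface `S` with `n` ordinary punctures and one distinguished puncture: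
for each puncture a reference point next to it and the class of a loop around it. -/
structure Punctures (S : Type*) [TopologicalSpace S] (n : ℕ) where
  pt : Fin n → S
  loop : ∀ i, FundamentalGroup S (pt i)
  ptInf : S
  loopInf : FundamentalGroup S ptInf

variable {S : Type*} [TopologicalSpace S]

/-- The loop at `p` that follows `e` to `q`, then runs through `κ`, and returns along `e`. -/
def lasso {p q : S} (e : Path p q) (κ : FundamentalGroup S q) : FundamentalGroup S p :=
  FundamentalGroup.fundamentalGroupMulEquivOfPath e.symm κ

theorem lasso_trans {p q p' : S} (c : Path p p') (e : Path p q) (κ : FundamentalGroup S q) :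
    lasso (c.symm.trans e) κ =
      FundamentalGroup.fundamentalGroupMulEquivOfPath c (lasso e κ) := by
  have key : ∀ {p q p' : FundamentalGroupoid S} (c : p ⟶ p') (e : p ⟶ q) (κ : q ⟶ q),
      ((Groupoid.isoEquivHom _ _).symm (Groupoid.inv (Groupoid.inv c ≫ e))).conj κ =
        ((Groupoid.isoEquivHom _ _).symm c).conj
          (((Groupoid.isoEquivHom _ _).symm (Groupoid.inv e)).conj κ) := by
    intro p q p' c e κ
    simp [Iso.conj_apply, Groupoid.isoEquivHom]
  exact key (p := .mk p) (q := .mk q) (p' := .mk p') ⟦c⟧ ⟦e⟧ κ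

theorem map_descProd {M N F : Type*} [Monoid M] [Monoid N] [FunLike F M N] [MonoidHomClass F M N]
    (φ : F) {n : ℕ} (f : Fin n → M) (i : ℕ) :
    φ (descProd f i) = descProd (fun l => φ (f l)) i := by
  simp only [descProd, map_list_prod, List.map_reverse, List.map_take, List.map_ofFn]
  rfl

/-- A system of generators `a j`, `b j`, `m i`, `lInf` of `π₁(S, p)` for a surface of genus `g`,
with `lInf [b_g, a_g⁻¹] ⋯ [b_1, a_1⁻¹] m_n ⋯ m_1 = 1`, where `m i` and `lInf` go from `p` to the
punctures along the paths `tail i` and `tailInf`. In `π₁` the right factor of a product is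
traversed first. -/
structure GeneratorSystem {n : ℕ} (P : Punctures S n) (g : ℕ) (p : S) where
  a : Fin g → FundamentalGroup S p
  b : Fin g → FundamentalGroup S p
  tail : ∀ i, Path p (P.pt i)
  tailInf : Path p P.ptInf
  relation : lasso tailInf P.loopInf * descProd (fun j => ⁅b j, (a j)⁻¹⁆) g *
    descProd (fun i => lasso (tail i) (P.loop i)) n = 1
  generates : Subgroup.closure (Set.range a ∪ Set.range b ∪
    Set.range (fun i => lasso (tail i) (P.loop i)) ∪ {lasso tailInf P.loopInf}) = ⊤

namespace GeneratorSystem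

variable {n g : ℕ} {P : Punctures S n} {p p' : S}

/-- The generator around the `i`-th ordinary puncture. -/
def m (Γ : GeneratorSystem P g p) (i : Fin n) : FundamentalGroup S p :=
  lasso (Γ.tail i) (P.loop i)

/-- The generator around the distinguished puncture. -/
def lInf (Γ : GeneratorSystem P g p) : FundamentalGroup S p := lasso Γ.tailInf P.loopInf

/-- Change of the basepoint from `p` to `p'` along a path `c`: every generator is transported by
the isomorphism `π₁(S, p) ≃ π₁(S, p')`, `γ ↦ c γ c⁻¹`. -/
def changeBasepoint (Γ : GeneratorSystem P g p) (c : Path p p') : GeneratorSystem P g p' where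
  a j := FundamentalGroup.fundamentalGroupMulEquivOfPath c (Γ.a j)
  b j := FundamentalGroup.fundamentalGroupMulEquivOfPath c (Γ.b j)
  tail i := c.symm.trans (Γ.tail i)
  tailInf := c.symm.trans Γ.tailInf
  relation := by
    have h := congrArg (FundamentalGroup.fundamentalGroupMulEquivOfPath c) Γ.relation
    simpa only [map_mul, map_one, map_descProd, map_commutatorElement, map_inv, lasso_trans]
      using h
  generates := by
    have h := congrArg (Subgroup.map
      (FundamentalGroup.fundamentalGroupMulEquivOfPath c).toMonoidHom) Γ.generates
    rw [MonoidHom.map_closure, Subgroup.map_top_of_surjective _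
      (FundamentalGroup.fundamentalGroupMulEquivOfPath c).surjective] at h
    simp only [Set.image_union, ← Set.range_comp, Set.image_singleton] at h
    simp only [lasso_trans]
    exact h

theorem changeBasepoint_m (Γ : GeneratorSystem P g p) (c : Path p p') (i : Fin n) :
    (Γ.changeBasepoint c).m i = FundamentalGroup.fundamentalGroupMulEquivOfPath c (Γ.m i) :=
  lasso_trans _ _ _

theorem changeBasepoint_lInf (Γ : GeneratorSystem P g p) (c : Path p p') :
    (Γ.changeBasepoint c).lInf = FundamentalGroup.fundamentalGroupMulEquivOfPath c Γ.lInf :=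
  lasso_trans _ _ _

end GeneratorSystem

end Surface

/-! ## Flat gauge fields and their holonomies -/

section Connection

variable (E : Type*) [NormedAddCommGroup E] [NormedSpace ℝ E]
  (G : Type*) [TopologicalSpace G] [ChartedSpace E G] [Group G] [LieGroup 𝓘(ℝ, E) ∞ G]

/-- A flat `G ⋉ 𝔤*`-gauge field on `S`, given by its parallel transport: homotopy classes of paths
are sent to elements of `G ⋉ 𝔤*`, compatibly with the composition of paths. -/
abbrev FlatConnection (S : Type*) [TopologicalSpace S] :=
  FundamentalGroupoid S ⥤ SingleObj (GaugeGroup E G)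

variable {E G} {S : Type*} [TopologicalSpace S]

/-- The parallel transport `PT_{p → q}` along a path `c` from `p` to `q`. -/
def parallelTransport (ρ : FlatConnection E G S) {p q : S} (c : Path p q) : GaugeGroup E G :=
  ρ.map (X := .mk p) (Y := .mk q) ⟦c⟧

/-- The holonomy of (the class of) a loop based at `p`. -/
def holonomy (ρ : FlatConnection E G S) {p : S} (γ : FundamentalGroup S p) : GaugeGroup E G :=
  ρ.map (X := .mk p) (Y := .mk p) γ

theorem holonomy_mul (ρ : FlatConnection E G S) {p : S} (γ γ' : FundamentalGroup S p) :
    holonomy ρ (γ * γ') = holonomy ρ γ * holonomy ρ γ' :=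
  ρ.map_comp _ _

theorem holonomy_one (ρ : FlatConnection E G S) {p : S} :
    holonomy ρ (1 : FundamentalGroup S p) = 1 :=
  ρ.map_id _

/-- The holonomy as a group homomorphism on `π₁(S, p)`. -/
def holonomyHom (ρ : FlatConnection E G S) (p : S) : FundamentalGroup S p →* GaugeGroup E G where
  toFun := holonomy ρ
  map_one' := holonomy_one ρ
  map_mul' := holonomy_mul ρ

/-- Transport of a loop `γ` along `c` from `p` to `p'` changes the holonomy to
`PT_{p → p'} H PT_{p → p'}⁻¹`. -/
theorem holonomy_transport (ρ : FlatConnection E G S) {p p' : S} (c : Path p p')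
    (γ : FundamentalGroup S p) :
    holonomy ρ (FundamentalGroup.fundamentalGroupMulEquivOfPath c γ) =
      parallelTransport ρ c * holonomy ρ γ * (parallelTransport ρ c)⁻¹ := by
  rw [eq_mul_inv_iff_mul_eq]
  have key : ∀ {p p' : FundamentalGroupoid S} (c : p ⟶ p') (γ : p ⟶ p),
      ρ.map c ≫ ρ.map (((Groupoid.isoEquivHom _ _).symm c).conj γ) = ρ.map γ ≫ ρ.map c := by
    intro p p' c γ
    rw [← ρ.map_comp, ← ρ.map_comp]
    simp [Iso.conj_apply, Groupoid.isoEquivHom]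
  exact key (p := .mk p) (p' := .mk p') ⟦c⟧ γ

theorem holonomy_lasso (ρ : FlatConnection E G S) {p q : S} (e : Path p q)
    (κ : FundamentalGroup S q) :
    holonomy ρ (lasso e κ) =
      (parallelTransport ρ e)⁻¹ * holonomy ρ κ * parallelTransport ρ e := by
  rw [mul_assoc, eq_inv_mul_iff_mul_eq]
  have key : ∀ {p q : FundamentalGroupoid S} (e : p ⟶ q) (κ : q ⟶ q),
      ρ.map (((Groupoid.isoEquivHom _ _).symm (Groupoid.inv e)).conj κ) ≫ ρ.map e =
        ρ.map e ≫ ρ.map κ := by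
    intro p q e κ
    rw [← ρ.map_comp, ← ρ.map_comp]
    simp [Iso.conj_apply, Groupoid.isoEquivHom]
  exact key (p := .mk p) (q := .mk q) ⟦e⟧ κ

variable {n : ℕ}

/-- A point of the space of fields. It consists of a flat gauge field on the punctured surface,
variables `w ∈ G ⋉ 𝔤*` and `μs = (μ, s) ∈ 𝔠`, and, for each puncture, the value at its reference
point of a gauge transformation on a punctured disc around it that brings the gauge field into the
standard singular form. The holonomies around the punctures are then conjugate by these values to
`(e^{-μ_i}, -s_i)` and to the inverse of `(e^{-μ}, -s)`. No basepoint enters. -/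
structure PuncturedField (P : Punctures S n) (orb : Fin n → E × StrongDual ℝ E)
    (𝔠 : Submodule ℝ (E × StrongDual ℝ E)) where
  conn : FlatConnection E G S
  frame : Fin n → GaugeGroup E G
  frameInf : GaugeGroup E G
  w : GaugeGroup E G
  μs : 𝔠
  holonomy_loop : ∀ i, holonomy conn (P.loop i) = frame i * expNeg (orb i) * (frame i)⁻¹
  holonomy_loopInf : (holonomy conn P.loopInf)⁻¹ =
    frameInf * expNeg (μs : E × StrongDual ℝ E) * frameInf⁻¹

variable {P : Punctures S n} {orb : Fin n → E × StrongDual ℝ E}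
  {𝔠 : Submodule ℝ (E × StrongDual ℝ E)}

/-- Smoothness on `U` of a family of fields: all parallel transports and all the other variables
depend smoothly on the parameter. -/
structure SmoothFamilyOn {V : Type*} [NormedAddCommGroup V] [NormedSpace ℝ V]
    (Φ : V → PuncturedField (E := E) (G := G) P orb 𝔠) (U : Set V) : Prop where
  parallelTransport : ∀ (p q : S) (c : Path p q),
    SmoothOn (fun x => parallelTransport (Φ x).conn c) U
  frame : ∀ i, SmoothOn (fun x => (Φ x).frame i) U
  frameInf : SmoothOn (fun x => (Φ x).frameInf) U
  w : SmoothOn (fun x => (Φ x).w) U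
  μs : ContDiffOn ℝ ∞ (fun x => ((Φ x).μs : E × StrongDual ℝ E)) U

/-- The coordinates in the extended phase space of a field `Φ`, defined with a basepoint `p` and
generators `Γ` of `π₁(S, p)`. They are the holonomies of the generators `a j` and `b j`, the
variables `w` and `(μ, s)`, and the elements `gM i` and `gInf` of `G ⋉ 𝔤*` that parametrise the
holonomies of `m i` and `lInf`, obtained from the values at the punctures by parallel transport
back to `p`. -/
def GeneratorSystem.coords {g : ℕ} {p : S} (Γ : GeneratorSystem P g p)
    (Φ : PuncturedField (E := E) (G := G) P orb 𝔠) : PhasePoint E G n g 𝔠 where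
  gM i := (ChernSimons.parallelTransport Φ.conn (Γ.tail i))⁻¹ * Φ.frame i
  A j := holonomy Φ.conn (Γ.a j)
  B j := holonomy Φ.conn (Γ.b j)
  gInf := (ChernSimons.parallelTransport Φ.conn Γ.tailInf)⁻¹ * Φ.frameInf
  w := Φ.w
  μs := Φ.μs

/-- The elements `M i` of `G ⋉ 𝔤*` are the holonomies of the generators `m i` at `p`. -/
theorem GeneratorSystem.coords_M {g : ℕ} {p : S} (Γ : GeneratorSystem P g p)
    (Φ : PuncturedField (E := E) (G := G) P orb 𝔠) (i : Fin n) :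
    (Γ.coords Φ).M orb i = holonomy Φ.conn (Γ.m i) := by
  rw [GeneratorSystem.m, holonomy_lasso, Φ.holonomy_loop]
  simp only [PhasePoint.M, GeneratorSystem.coords]
  group

/-- The coordinates of a field lie on the constraint surface. -/
theorem GeneratorSystem.coords_onConstraintSurface {g : ℕ} {p : S} (Γ : GeneratorSystem P g p)
    (Φ : PuncturedField (E := E) (G := G) P orb 𝔠) :
    (Γ.coords Φ).OnConstraintSurface orb := by
  have h := congrArg (holonomyHom Φ.conn p) Γ.relation
  rw [mul_assoc, map_mul, map_one, mul_eq_one_iff_inv_eq] at h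
  have hK : (Γ.coords Φ).KInv orb = (holonomy Φ.conn Γ.lInf)⁻¹ := by
    refine Eq.trans ?_ h.symm
    simp only [map_mul, map_descProd, map_commutatorElement, map_inv, PhasePoint.KInv]
    congr 2
    funext i
    exact Γ.coords_M Φ i
  have e : (holonomy Φ.conn Γ.lInf)⁻¹ = (parallelTransport Φ.conn Γ.tailInf)⁻¹ *
      (holonomy Φ.conn P.loopInf)⁻¹ * parallelTransport Φ.conn Γ.tailInf := by
    rw [GeneratorSystem.lInf, holonomy_lasso]
    group
  rw [PhasePoint.OnConstraintSurface, hK, e, Φ.holonomy_loopInf]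
  simp only [GeneratorSystem.coords]
  group

end Connection

end

end ChernSimons

open ChernSimons

namespace ChernSimons

noncomputable section

/-! ### Logarithmic derivatives of products and inverses -/

section LogDerivCalculus

variable {E : Type*} [NormedAddCommGroup E] [NormedSpace ℝ E]
  {G : Type*} [TopologicalSpace G] [ChartedSpace E G] [Group G] [LieGroup 𝓘(ℝ, E) ∞ G]
  {V : Type*} [NormedAddCommGroup V] [NormedSpace ℝ V]

/-! Moving the basepoint along a path acts on the coordinates by one simultaneous gauge
transformation, by the parallel transport `X` along the path: holonomies are conjugated, `gM` and
`gInf` are multiplied on the left, `w` and `(μ, s)` stay fixed (`coords_changeBasepoint`). Since `X`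
varies with the field, invariance under constant gauge transformations would not suffice. In fact
the one-form `potential` is already invariant, before taking the exterior derivative
(`potential_conj`).

Let `q` be the `G`-component of `X` and `lam = q⁻¹ δq`. Conjugation turns `R(u)` into `Ad(q)(lam +
R(u) - Ad(u) lam)`. Each puncture or handle term of `Θ` then changes by the increment of `⟨j_X,
R(u_Y) - Ad(u_Y) lam⟩ - ⟨j_Y, lam⟩` as the partial product `Y` acquires its next factor `M_i` or
`[B_i, A_i⁻¹]` (`variation_puncture`, `variation_handle`). The sum telescopes, leaving the values at
`Y = 1` and `Y = K⁻¹` (`Theta_conj`).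

Differentiating the constraint gives `R(u_K) = R(v_∞) - Ad(v_∞) δμ - Ad(u_K) R(v_∞)`, and with it
the remaining terms cancel against the changes of `⟨j_K, R(v_∞)⟩` and `⟨Ad*(v_∞) x_∞, δμ⟩`. This
needs `δ(e^{-μ}) e^{μ} = -δμ` (`rightLogDeriv_lieExp`), which holds because `μ` stays in a commuting
subspace. The required facts on one-parameter subgroups come from integral curves of left-invariant
fields. -/

theorem mdifferentiable_mul :
    MDifferentiable (𝓘(ℝ, E).prod 𝓘(ℝ, E)) 𝓘(ℝ, E) (fun p : G × G => p.1 * p.2) :=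
  (contMDiff_mul 𝓘(ℝ, E) (∞ : WithTop ℕ∞)).mdifferentiable (by simp)

theorem mdifferentiableAt_mul_left (a x : G) :
    MDifferentiableAt 𝓘(ℝ, E) 𝓘(ℝ, E) (fun y : G => a * y) x :=
  (contMDiff_mul_left (I := 𝓘(ℝ, E)) (n := ∞) (a := a)).contMDiffAt.mdifferentiableAt (by simp)

theorem mdifferentiableAt_mul_right (a x : G) :
    MDifferentiableAt 𝓘(ℝ, E) 𝓘(ℝ, E) (fun y : G => y * a) x :=
  (contMDiff_mul_right (I := 𝓘(ℝ, E)) (n := ∞) (a := a)).contMDiffAt.mdifferentiableAt (by simp)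

theorem mdifferentiableAt_conj (a x : G) :
    MDifferentiableAt 𝓘(ℝ, E) 𝓘(ℝ, E) (fun y : G => a * y * a⁻¹) x :=
  (mdifferentiableAt_mul_right a⁻¹ (a * x)).comp x (mdifferentiableAt_mul_left a x)

theorem hasMFDerivAt_conj (a : G) :
    HasMFDerivAt 𝓘(ℝ, E) 𝓘(ℝ, E) (fun y : G => a * y * a⁻¹) 1 (Ad a : E →L[ℝ] E) :=
  (mdifferentiableAt_conj a 1).hasMFDerivAt

theorem mdifferentiableAt_group_mul {u v : V → G} {x : V}
    (hu : MDifferentiableAt 𝓘(ℝ, V) 𝓘(ℝ, E) u x) (hv : MDifferentiableAt 𝓘(ℝ, V) 𝓘(ℝ, E) v x) :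
    MDifferentiableAt 𝓘(ℝ, V) 𝓘(ℝ, E) (fun y => u y * v y) x :=
  (mdifferentiable_mul (u x, v x)).comp x (hu.prodMk hv)

theorem mdifferentiableAt_group_inv {u : V → G} {x : V}
    (hu : MDifferentiableAt 𝓘(ℝ, V) 𝓘(ℝ, E) u x) :
    MDifferentiableAt 𝓘(ℝ, V) 𝓘(ℝ, E) (fun y => (u y)⁻¹) x :=
  ((contMDiff_inv 𝓘(ℝ, E) (∞ : WithTop ℕ∞)).mdifferentiable (by simp) (u x)).comp x hu

omit [Group G] [LieGroup 𝓘(ℝ, E) ∞ G] in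
theorem mfderiv_apply_of_eq_id {f : G → G} (hf : f = id) (x : G) (z : E) :
    (mfderiv 𝓘(ℝ, E) 𝓘(ℝ, E) f x : E →L[ℝ] E) z = z := by
  subst hf
  exact congrArg (fun T : E →L[ℝ] E => T z) (mfderiv_id (I := 𝓘(ℝ, E)) (x := x))

/-- Near the identity, multiplication is addition to first order. -/
theorem hasMFDerivAt_mul_of_eq_one {u v : V → G} {x : V} {L L' : V →L[ℝ] E}
    (hu : HasMFDerivAt 𝓘(ℝ, V) 𝓘(ℝ, E) u x L) (hv : HasMFDerivAt 𝓘(ℝ, V) 𝓘(ℝ, E) v x L')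
    (hu1 : u x = 1) (hv1 : v x = 1) :
    HasMFDerivAt 𝓘(ℝ, V) 𝓘(ℝ, E) (fun y => u y * v y) x (L + L') := by
  have hm := (mdifferentiable_mul (E := E) (G := G) (u x, v x)).hasMFDerivAt
  have h := hm.comp x (hu.prodMk hv)
  refine h.congr_mfderiv (ContinuousLinearMap.ext fun z => ?_)
  have e := mfderiv_prod_eq_add_apply (v := ((L z, L' z) : E × E))
    (mdifferentiable_mul (E := E) (G := G) (u x, v x))
  refine Eq.trans e (congrArg₂ (fun a b : E => a + b) ?_ ?_)
  · exact mfderiv_apply_of_eq_id (funext fun z => by simp [hv1]) (u x) (L z)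
  · exact mfderiv_apply_of_eq_id (funext fun z => by simp [hu1]) (v x) (L' z)

theorem hasMFDerivAt_rightLogDeriv {u : V → G} {x : V}
    (hu : MDifferentiableAt 𝓘(ℝ, V) 𝓘(ℝ, E) u x) :
    HasMFDerivAt 𝓘(ℝ, V) 𝓘(ℝ, E) (fun y => u y * (u x)⁻¹) x (rightLogDeriv u x : V →L[ℝ] E) :=
  (mdifferentiableAt_group_mul hu mdifferentiableAt_const).hasMFDerivAt

omit [LieGroup 𝓘(ℝ, E) ∞ G] in
theorem rightLogDeriv_eq {u : V → G} {x : V} {L : V →L[ℝ] E}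
    (h : HasMFDerivAt 𝓘(ℝ, V) 𝓘(ℝ, E) (fun y => u y * (u x)⁻¹) x L) : rightLogDeriv u x = L :=
  h.mfderiv

omit [LieGroup 𝓘(ℝ, E) ∞ G] in
theorem rightLogDeriv_const (a : G) (x : V) : rightLogDeriv (fun _ => a) x = (0 : V →L[ℝ] E) :=
  rightLogDeriv_eq (hasMFDerivAt_const _ _)

/-- With `u₀ = u x` and `v₀ = v x`, write `u v (u₀ v₀)⁻¹ = (u u₀⁻¹) · u₀ (v v₀⁻¹) u₀⁻¹`. Both
factors equal `1` at `x`, so their derivatives add, and conjugation by `u₀` contributes `Ad`. -/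
theorem rightLogDeriv_mul {u v : V → G} {x : V}
    (hu : MDifferentiableAt 𝓘(ℝ, V) 𝓘(ℝ, E) u x) (hv : MDifferentiableAt 𝓘(ℝ, V) 𝓘(ℝ, E) v x) :
    rightLogDeriv (fun y => u y * v y) x =
      (rightLogDeriv u x + (Ad (u x)).comp (rightLogDeriv v x) : V →L[ℝ] E) := by
  apply rightLogDeriv_eq
  have h1 := hasMFDerivAt_rightLogDeriv hu
  have h2 := hasMFDerivAt_rightLogDeriv hv
  have hc := hasMFDerivAt_conj (E := E) (u x)
  rw [← mul_inv_cancel (v x)] at hc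
  have h3 := hc.comp x h2
  have h4 := hasMFDerivAt_mul_of_eq_one h1 h3 (by simp) (by simp)
  have hf : (fun y => u y * v y * (u x * v x)⁻¹) =
      fun y => u y * (u x)⁻¹ * (u x * (v y * (v x)⁻¹) * (u x)⁻¹) := by
    ext y
    simp [mul_assoc]
  rw [hf]
  exact h4

theorem rightLogDeriv_inv {u : V → G} {x : V}
    (hu : MDifferentiableAt 𝓘(ℝ, V) 𝓘(ℝ, E) u x) :
    (Ad (u x)).comp (rightLogDeriv (fun y => (u y)⁻¹) x) = (-rightLogDeriv u x : V →L[ℝ] E) := by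
  have h := rightLogDeriv_mul hu (mdifferentiableAt_group_inv hu)
  simp only [mul_inv_cancel, rightLogDeriv_const] at h
  exact (neg_eq_of_add_eq_zero_right h.symm).symm

end LogDerivCalculus

/-! ### Existence and uniqueness of one-parameter subgroups -/

section OneParameterSubgroups

open Bundle Set Filter Topology

variable {E : Type*} [NormedAddCommGroup E] [NormedSpace ℝ E]
  {G : Type*} [TopologicalSpace G] [ChartedSpace E G] [Group G]

/-- The left-invariant vector field on `G` with value `ξ` at the identity. -/
def leftField (G : Type*) [TopologicalSpace G] [ChartedSpace E G] [Group G] (ξ : E) (g : G) :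
    TangentSpace 𝓘(ℝ, E) g :=
  mulInvariantVectorField (I := 𝓘(ℝ, E)) (G := G) ξ g

variable [LieGroup 𝓘(ℝ, E) ∞ G]

omit [Group G] [LieGroup 𝓘(ℝ, E) ∞ G] in
theorem totalSpace_mk_eq {g h : G} (e : g = h) {v w : E} (e' : v = w) :
    (⟨g, v⟩ : TangentBundle 𝓘(ℝ, E) G) = ⟨h, w⟩ := by
  subst e e'
  rfl

/-- The field is the tangent map of multiplication evaluated on the zero vector at `g` and `ξ` at
`1`, hence a composition of smooth maps. -/
theorem contMDiff_leftField (ξ : E) :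
    ContMDiff 𝓘(ℝ, E) 𝓘(ℝ, E).tangent ∞
      (fun g : G => (⟨g, leftField G ξ g⟩ : TangentBundle 𝓘(ℝ, E) G)) := by
  have : IsManifold 𝓘(ℝ, E) (∞ + 1) G := by
    change IsManifold 𝓘(ℝ, E) ∞ G
    infer_instance
  have : IsManifold 𝓘(ℝ, E) 1 G := IsManifold.of_le (n := ∞) (by simp)
  have h := (contMDiff_mul 𝓘(ℝ, E) (∞ : WithTop ℕ∞) (G := G)).contMDiff_tangentMap
    (m := ∞) (by simp)
  have h1 : ContMDiff 𝓘(ℝ, E) 𝓘(ℝ, E).tangent ∞ (fun g : G =>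
    (⟨g, 0⟩ : TangentBundle 𝓘(ℝ, E) G)) := contMDiff_zeroSection _ _
  have h2 : ContMDiff 𝓘(ℝ, E) 𝓘(ℝ, E).tangent ∞ (fun _ : G =>
    (⟨1, ξ⟩ : TangentBundle 𝓘(ℝ, E) G)) := contMDiff_const
  have h3 := h.comp (contMDiff_equivTangentBundleProd_symm.comp (h1.prodMk h2))
  refine h3.congr fun g => ?_
  have e := mfderiv_prod_eq_add_apply (v := ((0, ξ) : E × E))
    ((contMDiff_mul 𝓘(ℝ, E) (∞ : WithTop ℕ∞) (G := G)).mdifferentiableAt (x := (g, 1)) (by simp))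
  have e' : leftField G ξ g = (mfderiv (𝓘(ℝ, E).prod 𝓘(ℝ, E)) 𝓘(ℝ, E)
      (fun p : G × G => p.1 * p.2) (g, 1) : E × E →L[ℝ] E) ((0, ξ) : E × E) := by
    refine Eq.trans ?_ e.symm
    refine (zero_add (leftField G ξ g)).symm.trans ?_
    exact congrArg₂ (fun a b : E => a + b) (_root_.map_zero (mfderiv 𝓘(ℝ, E) 𝓘(ℝ, E)
      (fun z : G => z * 1) g : E →L[ℝ] E)).symm rfl
  exact totalSpace_mk_eq (mul_one g).symm e'

theorem contMDiff_one_leftField (ξ : E) :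
    ContMDiff 𝓘(ℝ, E) 𝓘(ℝ, E).tangent 1
      (fun g : G => (⟨g, leftField G ξ g⟩ : TangentBundle 𝓘(ℝ, E) G)) :=
  (contMDiff_leftField ξ).of_le (by simp)

theorem leftField_mul (g h : G) (ξ : E) :
    leftField G ξ (g * h) =
      (mfderiv 𝓘(ℝ, E) 𝓘(ℝ, E) (fun x : G => g * x) h : E →L[ℝ] E) (leftField G ξ h) := by
  have e := mfderiv_comp_of_eq (x := (1 : G)) (y := h) (mdifferentiableAt_mul_left (E := E) g h)
    (mdifferentiableAt_mul_left (E := E) h 1) (mul_one h)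
  have hf : (fun x : G => g * x) ∘ (fun x => h * x) = fun x => g * h * x := by
    ext x
    simp [mul_assoc]
  rw [hf] at e
  exact (congrArg (fun T : E →L[ℝ] E => T ξ) e).trans (congrArg (fun p : G =>
    (mfderiv 𝓘(ℝ, E) 𝓘(ℝ, E) (fun x : G => g * x) p : E →L[ℝ] E) (leftField G ξ h)) (mul_one h))

/-- Left invariance of the field. This gives the uniform existence time for integral curves and the
homomorphism property of the curve through `1`. -/
theorem isMIntegralCurveOn_mul_left {γ : ℝ → G} {ξ : E} {s : Set ℝ} (g : G)
    (hγ : IsMIntegralCurveOn γ (leftField (E := E) G ξ) s) :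
    IsMIntegralCurveOn (fun t => g * γ t) (leftField (E := E) G ξ) s := by
  intro t ht
  have h1 := (mdifferentiableAt_mul_left (E := E) g (γ t)).hasMFDerivAt.comp_hasMFDerivWithinAt t
    (hγ t ht)
  refine h1.congr_mfderiv ?_
  refine ContinuousLinearMap.ext fun z : ℝ => ?_
  refine (ContinuousLinearMap.map_smul (mfderiv 𝓘(ℝ, E) 𝓘(ℝ, E) (fun x : G => g * x)
    (γ t) : E →L[ℝ] E) z (leftField G ξ (γ t))).trans ?_
  exact congrArg (fun w : E => z • w) (leftField_mul g (γ t) ξ).symm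

theorem isMIntegralCurve_mul_left {γ : ℝ → G} {ξ : E} (g : G)
    (hγ : IsMIntegralCurve γ (leftField (E := E) G ξ)) :
    IsMIntegralCurve (fun t => g * γ t) (leftField (E := E) G ξ) := by
  rw [isMIntegralCurve_iff_isMIntegralCurveOn] at *
  exact isMIntegralCurveOn_mul_left g hγ

omit [LieGroup 𝓘(ℝ, E) ∞ G] in
theorem leftField_one (ξ : E) : leftField G ξ 1 = ξ := by
  unfold leftField mulInvariantVectorField
  exact mfderiv_apply_of_eq_id (by ext; simp) _ _

namespace IsOneParameterSubgroup

variable {φ ψ : ℝ → G} {ξ η : E}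

omit [LieGroup 𝓘(ℝ, E) ∞ G] in
theorem map_zero (h : IsOneParameterSubgroup φ ξ) : φ 0 = 1 := by
  have := h.map_add 0 0
  simpa using this

omit [LieGroup 𝓘(ℝ, E) ∞ G] in
theorem map_neg (h : IsOneParameterSubgroup φ ξ) (t : ℝ) : φ (-t) = (φ t)⁻¹ := by
  rw [eq_inv_iff_mul_eq_one, ← h.map_add, neg_add_cancel, h.map_zero]

omit [LieGroup 𝓘(ℝ, E) ∞ G] in
theorem hasMFDerivAt_zero (h : IsOneParameterSubgroup φ ξ) :
    HasMFDerivAt 𝓘(ℝ, ℝ) 𝓘(ℝ, E) φ 0 ((1 : ℝ →L[ℝ] ℝ).smulRight ξ) := by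
  have h1 := (h.smooth.mdifferentiable (by simp) 0).hasMFDerivAt
  refine h1.congr_mfderiv ?_
  refine ContinuousLinearMap.ext_ring ?_
  refine h.velocity.trans ?_
  exact (one_smul ℝ ξ).symm

/-- Since `φ s = φ t * φ (s - t)`, the velocity at `t` is the left translate of the velocity at `0`.
-/
theorem isMIntegralCurve (h : IsOneParameterSubgroup φ ξ) :
    IsMIntegralCurve φ (leftField (E := E) G ξ) := by
  intro t
  have h0 : HasMFDerivAt 𝓘(ℝ, ℝ) 𝓘(ℝ, E) φ (t - t) ((1 : ℝ →L[ℝ] ℝ).smulRight ξ) := by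
    rw [sub_self]
    exact h.hasMFDerivAt_zero
  have h1 : HasMFDerivAt 𝓘(ℝ, ℝ) 𝓘(ℝ, ℝ) (fun s : ℝ => s - t) t (ContinuousLinearMap.id ℝ ℝ) :=
    ((hasFDerivAt_id t).sub_const t).hasMFDerivAt
  have h2 : HasMFDerivAt 𝓘(ℝ, E) 𝓘(ℝ, E) (fun x : G => φ t * x) (φ (t - t))
      (mfderiv 𝓘(ℝ, E) 𝓘(ℝ, E) (fun x : G => φ t * x) (φ (t - t))) :=
    (mdifferentiableAt_mul_left (φ t) _).hasMFDerivAt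
  have h3 := h2.comp t (HasMFDerivAt.comp (f := fun s : ℝ => s - t) t h0 h1)
  have hf : (fun x : G => φ t * x) ∘ φ ∘ (fun s : ℝ => s - t) = φ := by
    ext s
    simp [← h.map_add]
  rw [hf] at h3
  refine h3.congr_mfderiv ?_
  refine ContinuousLinearMap.ext fun z : ℝ => ?_
  refine (ContinuousLinearMap.map_smul (mfderiv 𝓘(ℝ, E) 𝓘(ℝ, E) (fun x : G => φ t * x)
    (φ (t - t)) : E →L[ℝ] E) z ξ).trans ?_
  refine congrArg (fun w : E => z • w) ?_
  have e : φ (t - t) = 1 := by rw [sub_self, h.map_zero]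
  exact congrArg (fun p : G =>
    (mfderiv 𝓘(ℝ, E) 𝓘(ℝ, E) (fun x : G => φ t * x) p : E →L[ℝ] E) ξ) e

end IsOneParameterSubgroup

omit [LieGroup 𝓘(ℝ, E) ∞ G] [Group G] [ChartedSpace E G] [TopologicalSpace G] in
/-- Solutions of a smooth autonomous differential equation are smooth. -/
theorem contDiffAt_of_hasDerivAt {F : E → E} {f : ℝ → E} {t : ℝ}
    (hF : ContDiffAt ℝ ∞ F (f t)) (hf : ∀ᶠ s in 𝓝 t, HasDerivAt f (F (f s)) s) :
    ContDiffAt ℝ ∞ f t := by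
  refine contDiffAt_infty.2 fun n => ?_
  induction n with
  | zero =>
    exact contDiffAt_zero.2 ⟨{s | HasDerivAt f (F (f s)) s}, hf,
      fun s hs => HasDerivAt.continuousAt hs |>.continuousWithinAt⟩
  | succ n ih =>
    -- Bootstrapping: if `f` is `C^n`, so is `f' = F ∘ f`, and therefore `f` is `C^(n+1)`.
    rw [Nat.cast_add, Nat.cast_one, contDiffAt_succ_iff_hasFDerivAt]
    refine ⟨fun s => ContinuousLinearMap.toSpanSingleton ℝ (F (f s)),
      ⟨_, hf, fun s hs => HasDerivAt.hasFDerivAt hs⟩, ?_⟩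
    have h := (hF.of_le (mod_cast le_top)).comp t ih
    exact (ContinuousLinearMap.toSpanSingletonCLE (𝕜 := ℝ) (E := E)).contDiff.contDiffAt.comp t h

/-- A left-invariant vector field read in the chart at the identity. -/
def chartField (G : Type*) [TopologicalSpace G] [ChartedSpace E G] [Group G] (ξ : E) (z : E) : E :=
  VectorField.mpullbackWithin 𝓘(ℝ, E) 𝓘(ℝ, E) (extChartAt 𝓘(ℝ, E) (1 : G)).symm (leftField G ξ)
    (range 𝓘(ℝ, E)) z

theorem chartField_extChartAt (ξ : E) {g : G} (hg : g ∈ (extChartAt 𝓘(ℝ, E) (1 : G)).source) :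
    chartField G ξ (extChartAt 𝓘(ℝ, E) (1 : G) g) =
      (mfderiv 𝓘(ℝ, E) 𝓘(ℝ, E) (extChartAt 𝓘(ℝ, E) (1 : G)) g : E →L[ℝ] E) (leftField G ξ g) := by
  have : IsManifold 𝓘(ℝ, E) 1 G := IsManifold.of_le (n := ∞) (by simp)
  have e := ContinuousLinearMap.inverse_eq
    (mfderivWithin_extChartAt_symm_comp_mfderiv_extChartAt' (I := 𝓘(ℝ, E)) hg)
    (mfderiv_extChartAt_comp_mfderivWithin_extChartAt_symm' (I := 𝓘(ℝ, E)) hg)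
  have e1 : (extChartAt 𝓘(ℝ, E) (1 : G)).symm (extChartAt 𝓘(ℝ, E) (1 : G) g) = g :=
    (extChartAt 𝓘(ℝ, E) (1 : G)).left_inv hg
  refine (congrArg (fun T : E →L[ℝ] E => T (leftField G ξ ((extChartAt 𝓘(ℝ, E) (1 : G)).symm
    (extChartAt 𝓘(ℝ, E) (1 : G) g)))) e).trans ?_
  exact congrArg (fun h : G => (mfderiv 𝓘(ℝ, E) 𝓘(ℝ, E) (extChartAt 𝓘(ℝ, E) (1 : G)) g :
    E →L[ℝ] E) (leftField G ξ h)) e1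

theorem hasMFDerivAt_extChartAt_one {g : G} (hg : g ∈ (extChartAt 𝓘(ℝ, E) (1 : G)).source) :
    HasMFDerivAt 𝓘(ℝ, E) 𝓘(ℝ, E) (extChartAt 𝓘(ℝ, E) (1 : G)) g
      (mfderiv 𝓘(ℝ, E) 𝓘(ℝ, E) (extChartAt 𝓘(ℝ, E) (1 : G)) g) := by
  have : IsManifold 𝓘(ℝ, E) 1 G := IsManifold.of_le (n := ∞) (by simp)
  exact (mdifferentiableAt_extChartAt (by simpa using hg)).hasMFDerivAt

/-- Turns the integral curve equation on `G` into an autonomous differential equation in `E`, as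
long as the curve stays in the chart domain. -/
theorem hasDerivAt_extChartAt_comp {γ : ℝ → G} {ξ : E} {t : ℝ}
    (hγ : HasMFDerivAt 𝓘(ℝ, ℝ) 𝓘(ℝ, E) γ t
      ((1 : ℝ →L[ℝ] ℝ).smulRight (leftField (E := E) G ξ (γ t))))
    (ht : γ t ∈ (extChartAt 𝓘(ℝ, E) (1 : G)).source) :
    HasDerivAt (fun s => extChartAt 𝓘(ℝ, E) (1 : G) (γ s))
      (chartField G ξ (extChartAt 𝓘(ℝ, E) (1 : G) (γ t))) t := by
  have h := (hasMFDerivAt_extChartAt_one ht).comp t hγ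
  refine HasMFDerivAt.hasFDerivAt (h.congr_mfderiv (ContinuousLinearMap.ext fun z : ℝ => ?_))
  refine (ContinuousLinearMap.map_smul (mfderiv 𝓘(ℝ, E) 𝓘(ℝ, E) (extChartAt 𝓘(ℝ, E) (1 : G))
    (γ t) : E →L[ℝ] E) z (leftField (E := E) G ξ (γ t))).trans ?_
  exact congrArg (fun w : E => z • w) (chartField_extChartAt ξ ht).symm

variable [CompleteSpace E]

theorem contDiffAt_chartField (ξ : E) :
    ContDiffAt ℝ ∞ (chartField G ξ) (extChartAt 𝓘(ℝ, E) (1 : G) 1) := by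
  have : IsManifold 𝓘(ℝ, E) (∞ + 1) G := by
    change IsManifold 𝓘(ℝ, E) ∞ G
    infer_instance
  have h := VectorField.contMDiffWithinAt_mpullbackWithin_extChartAt_symm
    (contMDiff_leftField (G := G) ξ).contMDiffAt.contMDiffWithinAt uniqueMDiffOn_univ
    (mem_univ (1 : G)) (n := ∞) (m := ∞) (by simp)
  rw [contMDiffWithinAt_vectorSpace_iff_contDiffWithinAt] at h
  refine h.contDiffAt ?_
  simpa using extChartAt_target_mem_nhds (I := 𝓘(ℝ, E)) (1 : G)

variable [T2Space G]

omit [CompleteSpace E] in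
theorem eq_of_isMIntegralCurve {γ γ' : ℝ → G} {ξ : E}
    (h : IsMIntegralCurve γ (leftField (E := E) G ξ))
    (h' : IsMIntegralCurve γ' (leftField (E := E) G ξ)) (h0 : γ 0 = γ' 0) : γ = γ' := by
  have : IsManifold 𝓘(ℝ, E) 1 G := IsManifold.of_le (n := ∞) (by simp)
  exact isMIntegralCurve_Ioo_eq_of_contMDiff_boundaryless (contMDiff_one_leftField ξ) h h' h0

/-- Left translates of one local curve through `1` provide curves through all points on the same
interval `(-ε, ε)`; a uniform existence time implies completeness. -/
theorem exists_isMIntegralCurve (G : Type*) [TopologicalSpace G] [ChartedSpace E G] [Group G]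
    [LieGroup 𝓘(ℝ, E) ∞ G] [T2Space G] (ξ : E) :
    ∃ γ : ℝ → G, γ 0 = 1 ∧ IsMIntegralCurve γ (leftField (E := E) G ξ) := by
  have : IsManifold 𝓘(ℝ, E) 1 G := IsManifold.of_le (n := ∞) (by simp)
  have hv := contMDiff_one_leftField (G := G) ξ
  obtain ⟨γ, hγ, h⟩ := exists_isMIntegralCurveAt_of_contMDiffAt_boundaryless 0
    (hv.contMDiffAt (x := 1))
  obtain ⟨ε, hε, h⟩ := isMIntegralCurveAt_iff'.1 h
  refine exists_isMIntegralCurve_of_isMIntegralCurveOn hv hε (fun g => ⟨fun t => g * γ t, ?_, ?_⟩) 1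
  · simp [hγ]
  · have := isMIntegralCurveOn_mul_left g h
    rwa [Real.ball_eq_Ioo, zero_sub, zero_add] at this

theorem exists_isOneParameterSubgroup (G : Type*) [TopologicalSpace G] [ChartedSpace E G] [Group G]
    [LieGroup 𝓘(ℝ, E) ∞ G] [T2Space G] (ξ : E) :
    ∃ φ : ℝ → G, IsOneParameterSubgroup φ ξ := by
  have : IsManifold 𝓘(ℝ, E) 1 G := IsManifold.of_le (n := ∞) (by simp)
  obtain ⟨γ, h0, hγ⟩ := exists_isMIntegralCurve G ξ
  have hadd : ∀ s t : ℝ, γ (s + t) = γ s * γ t := by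
    intro s t
    -- The left translate by `γ s` and the time shift by `s` are integral curves that agree at time
    -- `0`.
    have e := congrFun (eq_of_isMIntegralCurve (isMIntegralCurve_mul_left (γ s) hγ)
      (hγ.comp_add s) (by simp [h0])) t
    rw [add_comm]
    exact e.symm
  have hsm : ContMDiffAt 𝓘(ℝ, ℝ) 𝓘(ℝ, E) ∞ γ 0 := by
    have hs : ∀ᶠ t in 𝓝 (0 : ℝ), γ t ∈ (extChartAt 𝓘(ℝ, E) (1 : G)).source :=
      hγ.continuous.continuousAt.eventually_mem (by
        rw [h0]
        exact extChartAt_source_mem_nhds 1)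
    have hc := contDiffAt_of_hasDerivAt (t := 0) (F := chartField G ξ)
      (f := fun s => extChartAt 𝓘(ℝ, E) (1 : G) (γ s)) (by
        rw [h0]
        exact contDiffAt_chartField ξ)
      (hs.mono fun t ht => hasDerivAt_extChartAt_comp (hγ t) ht)
    rw [contMDiffAt_iff_target, h0]
    exact ⟨hγ.continuous.continuousAt, hc.contMDiffAt⟩
  refine ⟨γ, hadd, fun t => ?_, ?_⟩
  -- Smoothness was obtained at `0` in the chart at `1`; the homomorphism property carries it to
  -- every `t`.
  · have hf : γ = fun s => γ t * γ (s - t) := by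
      ext s
      rw [← hadd, add_sub_cancel]
    rw [hf]
    have h1 : ContMDiffAt 𝓘(ℝ, ℝ) 𝓘(ℝ, E) ∞ γ (t - t) := by rwa [sub_self]
    have h2 : ContMDiffAt 𝓘(ℝ, ℝ) 𝓘(ℝ, ℝ) ∞ (fun s => s - t) t :=
      (contDiff_id.sub contDiff_const).contMDiff.contMDiffAt
    exact (contMDiff_mul_left (I := 𝓘(ℝ, E)) (n := ∞) (a := γ t)).contMDiffAt.comp t
      (ContMDiffAt.comp (f := fun s : ℝ => s - t) t h1 h2)
  · have h1 := (hγ 0).mfderiv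
    refine (congrArg (fun T : ℝ →L[ℝ] E => T 1) h1).trans ?_
    refine (one_smul ℝ (leftField G ξ (γ 0) : E)).trans ?_
    rw [h0, leftField_one]

omit [CompleteSpace E] in
theorem IsOneParameterSubgroup.unique {φ ψ : ℝ → G} {ξ : E} (h : IsOneParameterSubgroup φ ξ)
    (h' : IsOneParameterSubgroup ψ ξ) : φ = ψ :=
  eq_of_isMIntegralCurve h.isMIntegralCurve h'.isMIntegralCurve (by rw [h.map_zero, h'.map_zero])

/-- The rescaled curve `s ↦ φ (s * t)` has velocity `t • ξ`, so by uniqueness it is the curve chosen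
in `lieExp`. Existence rules out the default value `1` of that definition. -/
theorem lieExp_smul_eq {φ : ℝ → G} {ξ : E} (h : IsOneParameterSubgroup φ ξ) (t : ℝ) :
    lieExp G (t • ξ) = φ t := by
  have hex := exists_isOneParameterSubgroup G (t • ξ)
  have hsc : IsOneParameterSubgroup (fun s => φ (s * t)) (t • ξ) :=
    { map_add := fun a b => by rw [add_mul, h.map_add]
      smooth := h.smooth.comp (contDiff_id.mul contDiff_const).contMDiff
      velocity := by
        have h0 : HasMFDerivAt 𝓘(ℝ, ℝ) 𝓘(ℝ, E) φ (0 * t) ((1 : ℝ →L[ℝ] ℝ).smulRight ξ) := by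
          rw [zero_mul]
          exact h.hasMFDerivAt_zero
        have h1 : HasMFDerivAt 𝓘(ℝ, ℝ) 𝓘(ℝ, ℝ) (fun s : ℝ => s * t) 0
            ((1 : ℝ →L[ℝ] ℝ).smulRight t) := by
          refine HasFDerivAt.hasMFDerivAt ?_
          exact (hasDerivAt_mul_const t).hasFDerivAt
        have h2 := (HasMFDerivAt.comp (f := fun s : ℝ => s * t) 0 h0 h1).mfderiv
        refine (congrArg (fun T : ℝ →L[ℝ] E => T 1) h2).trans ?_
        change ((1 : ℝ) • t) • ξ = t • ξ
        rw [one_smul] }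
  rw [lieExp, dif_pos hex, hex.choose_spec.unique hsc]
  simp

/-- `t ↦ e^{tξ}` is the one-parameter subgroup with initial velocity `ξ`. -/
theorem isOneParameterSubgroup_lieExp (ξ : E) :
    IsOneParameterSubgroup (fun t : ℝ => lieExp G (t • ξ)) ξ := by
  obtain ⟨φ, hφ⟩ := exists_isOneParameterSubgroup G ξ
  convert! hφ using 1
  ext t
  exact lieExp_smul_eq hφ t

end OneParameterSubgroups

/-! ### Vanishing brackets, commuting exponentials, and the derivative of the exponential map -/

section CommutingSubgroups

open Set Filter Topology

section SecondDerivative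

variable {W F : Type*} [NormedAddCommGroup W] [NormedSpace ℝ W] [NormedAddCommGroup F]
  [NormedSpace ℝ F]

/-- The second derivative as an iterated directional derivative. -/
theorem hasDerivAt_deriv_of_contDiffAt {k : W → F} (hk : ContDiffAt ℝ ∞ k 0) (u v : W) :
    HasDerivAt (fun t : ℝ => deriv (fun s : ℝ => k (t • u + s • v)) 0)
      (fderiv ℝ (fderiv ℝ k) 0 u v) 0 := by
  have hc : ContinuousAt (fun t : ℝ => t • u) 0 := by fun_prop
  have hd : ∀ᶠ w in 𝓝 (0 : W), DifferentiableAt ℝ k w :=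
    ((hk.of_le (m := 1) (by simp)).eventually (by simp)).mono
      fun w hw => hw.differentiableAt (by simp)
  have hd' : ∀ᶠ t in 𝓝 (0 : ℝ), DifferentiableAt ℝ k (t • u) :=
    hc.eventually (by simpa using hd)
  have he : (fun t : ℝ => deriv (fun s : ℝ => k (t • u + s • v)) 0) =ᶠ[𝓝 0]
      fun t => fderiv ℝ k (t • u) v := by
    filter_upwards [hd'] with t ht
    have h1 : HasDerivAt (fun s : ℝ => t • u + s • v) v 0 := by
      simpa using ((hasDerivAt_id (0 : ℝ)).smul_const v).const_add (t • u)
    have h2 : HasFDerivAt k (fderiv ℝ k (t • u)) (t • u + (0 : ℝ) • v) := by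
      simpa using ht.hasFDerivAt
    exact (h2.comp_hasDerivAt 0 h1).deriv
  refine HasDerivAt.congr_of_eventuallyEq ?_ he
  have h1 : HasDerivAt (fun t : ℝ => t • u) u 0 := by
    simpa using (hasDerivAt_id (0 : ℝ)).smul_const u
  have h2 : HasFDerivAt (fderiv ℝ k) (fderiv ℝ (fderiv ℝ k) 0) ((0 : ℝ) • u) := by
    rw [zero_smul]
    exact ((hk.fderiv_right (m := ∞) (by simp)).differentiableAt (by simp)).hasFDerivAt
  have h3 := h2.comp_hasDerivAt 0 h1
  exact (ContinuousLinearMap.apply ℝ F v).hasFDerivAt.comp_hasDerivAt 0 h3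

end SecondDerivative

variable {E : Type*} [NormedAddCommGroup E] [NormedSpace ℝ E]
  {G : Type*} [TopologicalSpace G] [ChartedSpace E G] [Group G] [LieGroup 𝓘(ℝ, E) ∞ G]

omit [LieGroup 𝓘(ℝ, E) ∞ G] in
theorem eventually_mem_chart {X : Type*} [TopologicalSpace X] {F : X → G} {x : X}
    (hF : ContinuousAt F x) (hx : F x = 1) :
    ∀ᶠ y in 𝓝 x, F y ∈ (extChartAt 𝓘(ℝ, E) (1 : G)).source :=
  hF.eventually_mem (by
    rw [hx]
    exact extChartAt_source_mem_nhds 1)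

/-- One function of three variables contains `φ(t) ψ(s)`, `ψ(t) φ(s)` and `φ(t) ψ(s) φ(t)⁻¹` as
restrictions to planes, so their mixed derivatives come from a single Hessian. -/
theorem contDiffAt_chart_product {φ ψ : ℝ → G} {ξ η : E} (hφ : IsOneParameterSubgroup φ ξ)
    (hψ : IsOneParameterSubgroup ψ η) :
    ContDiffAt ℝ ∞ (fun p : ℝ × ℝ × ℝ =>
      extChartAt 𝓘(ℝ, E) (1 : G) (φ p.1 * ψ p.2.1 * φ p.2.2)) 0 := by
  have h1 : ContMDiff 𝓘(ℝ, ℝ × ℝ × ℝ) 𝓘(ℝ, E) ∞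
      (fun p : ℝ × ℝ × ℝ => φ p.1 * ψ p.2.1 * φ p.2.2) :=
    ((hφ.smooth.comp contDiff_fst.contMDiff).mul
      (hψ.smooth.comp contDiff_snd.fst.contMDiff)).mul
      (hφ.smooth.comp contDiff_snd.snd.contMDiff)
  have h2 := (contMDiffAt_iff_target.1 (h1 0)).2.contDiffAt
  simpa [Function.comp_def, hφ.map_zero, hψ.map_zero] using h2

theorem deriv_chart_mul {ψ : ℝ → G} {η : E} (hψ : IsOneParameterSubgroup ψ η) {g : G}
    (hg : g ∈ (extChartAt 𝓘(ℝ, E) (1 : G)).source) :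
    deriv (fun s => extChartAt 𝓘(ℝ, E) (1 : G) (g * ψ s)) 0 =
      chartField G η (extChartAt 𝓘(ℝ, E) (1 : G) g) := by
  have h := hasDerivAt_extChartAt_comp (isMIntegralCurve_mul_left g hψ.isMIntegralCurve 0)
    (by simpa [hψ.map_zero] using hg)
  rw [h.deriv, hψ.map_zero, mul_one]

theorem hasDerivAt_chart_mul [CompleteSpace E] {φ ψ : ℝ → G} {ξ η : E}
    (hφ : IsOneParameterSubgroup φ ξ) (hψ : IsOneParameterSubgroup ψ η) :
    HasDerivAt (fun t => deriv (fun s => extChartAt 𝓘(ℝ, E) (1 : G) (φ t * ψ s)) 0)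
      (fderiv ℝ (chartField G η) (extChartAt 𝓘(ℝ, E) (1 : G) 1)
        (chartField G ξ (extChartAt 𝓘(ℝ, E) (1 : G) 1))) 0 := by
  have hs := eventually_mem_chart (E := E) hφ.smooth.continuous.continuousAt hφ.map_zero
  refine HasDerivAt.congr_of_eventuallyEq ?_ (hs.mono fun t ht => deriv_chart_mul hψ ht)
  have h1 := hasDerivAt_extChartAt_comp (hφ.isMIntegralCurve 0) hs.self_of_nhds
  have h2 : HasFDerivAt (chartField G η)
      (fderiv ℝ (chartField G η) (extChartAt 𝓘(ℝ, E) (1 : G) 1))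
      (extChartAt 𝓘(ℝ, E) (1 : G) (φ 0)) := by
    rw [hφ.map_zero]
    exact ((contDiffAt_chartField η).differentiableAt (by simp)).hasFDerivAt
  have h3 := h2.comp_hasDerivAt 0 h1
  rw [hφ.map_zero] at h3
  exact h3

/-- The bracket on `𝔤` is that of the left-invariant fields in the chart at `1`, whose derivative
there is the identity. The two sides are the terms whose difference is this bracket. -/
theorem chartField_commute {ξ η : E} (h : lieBracket G ξ η = 0) :
    fderiv ℝ (chartField G η) (extChartAt 𝓘(ℝ, E) (1 : G) 1)
        (chartField G ξ (extChartAt 𝓘(ℝ, E) (1 : G) 1)) =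
      fderiv ℝ (chartField G ξ) (extChartAt 𝓘(ℝ, E) (1 : G) 1)
        (chartField G η (extChartAt 𝓘(ℝ, E) (1 : G) 1)) := by
  have : IsManifold 𝓘(ℝ, E) 1 G := IsManifold.of_le (n := ∞) (by simp)
  have e : lieBracket G ξ η = VectorField.lieBracketWithin ℝ (chartField G ξ) (chartField G η)
      ((extChartAt 𝓘(ℝ, E) (1 : G)).symm ⁻¹' univ ∩ range 𝓘(ℝ, E))
      (extChartAt 𝓘(ℝ, E) (1 : G) 1) := by
    have hi : (mfderiv 𝓘(ℝ, E) 𝓘(ℝ, E) (extChartAt 𝓘(ℝ, E) (1 : G)) 1 : E →L[ℝ] E).inverse =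
        ContinuousLinearMap.id ℝ E := by
      have : (mfderiv 𝓘(ℝ, E) 𝓘(ℝ, E) (extChartAt 𝓘(ℝ, E) (1 : G)) 1 : E →L[ℝ] E) =
        ContinuousLinearMap.id ℝ E := mfderiv_extChartAt_self
      exact (congrArg (fun T : E →L[ℝ] E => T.inverse) this).trans ContinuousLinearMap.inverse_id
    exact congrArg (fun T : E →L[ℝ] E => T (VectorField.lieBracketWithin ℝ (chartField G ξ)
      (chartField G η) ((extChartAt 𝓘(ℝ, E) (1 : G)).symm ⁻¹' univ ∩ range 𝓘(ℝ, E))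
      (extChartAt 𝓘(ℝ, E) (1 : G) 1))) hi
  rw [h] at e
  simp only [preimage_univ, univ_inter, modelWithCornersSelf_coe, range_id,
    VectorField.lieBracketWithin_univ, VectorField.lieBracket_eq] at e
  exact sub_eq_zero.1 e.symm

theorem deriv_chart_conj {ψ : ℝ → G} {η : E} (hψ : IsOneParameterSubgroup ψ η) (g : G) :
    deriv (fun s => extChartAt 𝓘(ℝ, E) (1 : G) (g * ψ s * g⁻¹)) 0 = Ad g η := by
  have : IsManifold 𝓘(ℝ, E) 1 G := IsManifold.of_le (n := ∞) (by simp)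
  have h1 : HasMFDerivAt 𝓘(ℝ, E) 𝓘(ℝ, E) (fun y : G => g * y * g⁻¹) (ψ 0) (Ad g : E →L[ℝ] E) := by
    rw [hψ.map_zero]
    exact hasMFDerivAt_conj g
  have h2 : HasMFDerivAt 𝓘(ℝ, E) 𝓘(ℝ, E) (extChartAt 𝓘(ℝ, E) (1 : G)) (g * ψ 0 * g⁻¹)
      (ContinuousLinearMap.id ℝ E) := by
    have e : g * ψ 0 * g⁻¹ = 1 := by simp [hψ.map_zero]
    rw [e]
    exact (hasMFDerivAt_extChartAt_one (mem_extChartAt_source 1)).congr_mfderiv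
      mfderiv_extChartAt_self
  have h3 := h2.comp 0 (HasMFDerivAt.comp (f := ψ) 0 h1 hψ.hasMFDerivAt_zero)
  have h4 : HasFDerivAt (fun s => extChartAt 𝓘(ℝ, E) (1 : G) (g * ψ s * g⁻¹))
      ((ContinuousLinearMap.id ℝ E).comp ((Ad g : E →L[ℝ] E).comp ((1 : ℝ →L[ℝ] ℝ).smulRight η))) 0 :=
    h3.hasFDerivAt
  rw [h4.hasDerivAt.deriv]
  simp

theorem IsOneParameterSubgroup.conj {ψ : ℝ → G} {η : E} (hψ : IsOneParameterSubgroup ψ η) (g : G) :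
    IsOneParameterSubgroup (fun t => g * ψ t * g⁻¹) (Ad g η) where
  map_add s t := by simp [hψ.map_add, mul_assoc]
  smooth := (contMDiff_const.mul hψ.smooth).mul contMDiff_const
  velocity := by
    have h1 : HasMFDerivAt 𝓘(ℝ, E) 𝓘(ℝ, E) (fun y : G => g * y * g⁻¹) (ψ 0)
        (Ad g : E →L[ℝ] E) := by
      rw [hψ.map_zero]
      exact hasMFDerivAt_conj g
    have h2 := (HasMFDerivAt.comp (f := ψ) 0 h1 hψ.hasMFDerivAt_zero).mfderiv
    refine (congrArg (fun T : ℝ →L[ℝ] E => T 1) h2).trans ?_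
    exact congrArg (Ad g : E →L[ℝ] E) (one_smul ℝ η)

variable [CompleteSpace E] [T2Space G]

/-- The derivative of `Ad(φ t) η` at `0` is the bracket, read off as a difference of two mixed
second derivatives of `k`. -/
theorem hasDerivAt_Ad_zero {φ : ℝ → G} {ξ η : E} (hφ : IsOneParameterSubgroup φ ξ)
    (h : lieBracket G ξ η = 0) : HasDerivAt (fun t => Ad (φ t) η) 0 0 := by
  obtain ⟨ψ, hψ⟩ := exists_isOneParameterSubgroup G η
  have hk := contDiffAt_chart_product hφ hψ
  set k : ℝ × ℝ × ℝ → E := fun p =>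
    extChartAt 𝓘(ℝ, E) (1 : G) (φ p.1 * ψ p.2.1 * φ p.2.2) with hkdef
  have h12 := hasDerivAt_deriv_of_contDiffAt hk (1, 0, 0) (0, 1, 0)
  have h23 := hasDerivAt_deriv_of_contDiffAt hk (0, 1, 0) (0, 0, 1)
  -- Along `(1, 0, -1)` the outer factors are `φ(t)` and `φ(-t) = φ(t)⁻¹`, which gives conjugation.
  -- Bilinearity and symmetry of the Hessian reduce this case to `h12` and `h23`.
  have hA := hasDerivAt_deriv_of_contDiffAt hk (1, 0, -1) (0, 1, 0)
  simp only [hkdef, Prod.smul_mk, Prod.mk_add_mk, smul_eq_mul, mul_one, mul_zero, add_zero,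
    zero_add, mul_neg, hφ.map_zero, one_mul, hφ.map_neg] at h12 h23 hA
  simp only [deriv_chart_conj hψ] at hA
  have e12 := h12.unique (hasDerivAt_chart_mul hφ hψ)
  have e23 := h23.unique (hasDerivAt_chart_mul hψ hφ)
  have hsymm := (hk.isSymmSndFDerivAt (by
    rw [minSmoothness_of_isRCLikeNormedField]
    exact WithTop.coe_le_coe.2 (le_top : (2 : ℕ∞) ≤ ⊤))).eq (0, 0, 1) (0, 1, 0)
  have hlin : ((1, 0, -1) : ℝ × ℝ × ℝ) = (1, 0, 0) - (0, 0, 1) := by simp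
  convert! hA using 1
  rw [hlin, map_sub, sub_apply]
  exact (sub_eq_zero.2 (e12.trans ((chartField_commute h).trans (e23.symm.trans hsymm.symm)))).symm

/-- A one-parameter subgroup acts trivially on the vectors that commute with its velocity. -/
theorem Ad_apply_eq_self {φ : ℝ → G} {ξ η : E} (hφ : IsOneParameterSubgroup φ ξ)
    (h : lieBracket G ξ η = 0) (t : ℝ) : Ad (φ t) η = η := by
  have hd : ∀ t, HasDerivAt (fun s => Ad (φ s) η) 0 t := by
    intro t
    -- The group law moves the vanishing derivative from `0` to an arbitrary `t`.
    have hf : (fun s => Ad (φ s) η) = fun s => (Ad (φ t) : E →L[ℝ] E) (Ad (φ (s - t)) η) := by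
      ext s
      rw [← ContinuousLinearMap.comp_apply, ← Ad_mul, ← hφ.map_add, add_sub_cancel]
    have h0 : HasDerivAt (fun s => Ad (φ s) η) 0 (t - t) := by
      rw [sub_self]
      exact hasDerivAt_Ad_zero hφ h
    have h1 := (Ad (φ t) : E →L[ℝ] E).hasFDerivAt.comp_hasDerivAt t (h0.comp_sub_const t t)
    rw [map_zero] at h1
    rw [hf]
    exact h1
  have h1 := is_const_of_deriv_eq_zero (fun t => (hd t).differentiableAt)
    (fun t => (hd t).deriv) t 0
  rw [h1, hφ.map_zero, Ad_one]
  rfl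

/-- Conjugating `ψ` by `φ s` yields a one-parameter subgroup with velocity `Ad(φ s) η = η`, which is
`ψ` by uniqueness. -/
theorem IsOneParameterSubgroup.commute {φ ψ : ℝ → G} {ξ η : E} (hφ : IsOneParameterSubgroup φ ξ)
    (hψ : IsOneParameterSubgroup ψ η) (h : lieBracket G ξ η = 0) (s t : ℝ) :
    φ s * ψ t = ψ t * φ s := by
  have h1 := hψ.conj (φ s)
  rw [Ad_apply_eq_self hφ h] at h1
  rw [← mul_inv_eq_iff_eq_mul]
  exact congrFun (h1.unique hψ) t

theorem IsOneParameterSubgroup.mul {φ ψ : ℝ → G} {ξ η : E} (hφ : IsOneParameterSubgroup φ ξ)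
    (hψ : IsOneParameterSubgroup ψ η) (h : lieBracket G ξ η = 0) :
    IsOneParameterSubgroup (fun t => φ t * ψ t) (ξ + η) where
  map_add s t := by
    rw [hφ.map_add, hψ.map_add, mul_assoc, mul_assoc, ← mul_assoc (φ t),
      hφ.commute hψ h t s, mul_assoc]
  smooth := hφ.smooth.mul hψ.smooth
  velocity := by
    have h1 := (hasMFDerivAt_mul_of_eq_one hφ.hasMFDerivAt_zero hψ.hasMFDerivAt_zero
      hφ.map_zero hψ.map_zero).mfderiv
    refine (congrArg (fun T : ℝ →L[ℝ] E => T 1) h1).trans ?_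
    exact congrArg₂ (fun a b : E => a + b) (one_smul ℝ ξ) (one_smul ℝ η)

theorem lieExp_eq {φ : ℝ → G} {ξ : E} (h : IsOneParameterSubgroup φ ξ) : lieExp G ξ = φ 1 := by
  rw [← lieExp_smul_eq h, one_smul]

theorem lieExp_add {ξ η : E} (h : lieBracket G ξ η = 0) :
    lieExp G (ξ + η) = lieExp G ξ * lieExp G η := by
  obtain ⟨φ, hφ⟩ := exists_isOneParameterSubgroup G ξ
  obtain ⟨ψ, hψ⟩ := exists_isOneParameterSubgroup G η
  rw [lieExp_eq (hφ.mul hψ h), lieExp_eq hφ, lieExp_eq hψ]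

theorem Ad_lieExp {ξ η : E} (h : lieBracket G ξ η = 0) : Ad (lieExp G ξ) η = η := by
  obtain ⟨φ, hφ⟩ := exists_isOneParameterSubgroup G ξ
  rw [lieExp_eq hφ]
  exact Ad_apply_eq_self hφ h 1

variable {V : Type*} [NormedAddCommGroup V] [NormedSpace ℝ V]

theorem mdifferentiableAt_lieExp_smul {c : V → ℝ} {x : V} (hc : DifferentiableAt ℝ c x) (ξ : E) :
    MDifferentiableAt 𝓘(ℝ, V) 𝓘(ℝ, E) (fun y => lieExp G (c y • ξ)) x := by
  have h := (isOneParameterSubgroup_lieExp (G := G) ξ).smooth.mdifferentiable (by simp) (c x)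
  exact MDifferentiableAt.comp (f := c) x h hc.mdifferentiableAt

theorem rightLogDeriv_lieExp_smul {c : V → ℝ} {x : V} (hc : DifferentiableAt ℝ c x) (ξ : E) :
    rightLogDeriv (fun y => lieExp G (c y • ξ)) x = (fderiv ℝ c x).smulRight ξ := by
  obtain ⟨φ, hφ⟩ := exists_isOneParameterSubgroup G ξ
  apply rightLogDeriv_eq
  have hf : (fun y => lieExp G (c y • ξ) * (lieExp G (c x • ξ))⁻¹) = fun y => φ (c y - c x) := by
    ext y
    rw [lieExp_smul_eq hφ, lieExp_smul_eq hφ, ← hφ.map_neg, ← hφ.map_add, sub_eq_add_neg]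
  rw [hf]
  have h0 : HasMFDerivAt 𝓘(ℝ, ℝ) 𝓘(ℝ, E) φ (c x - c x) ((1 : ℝ →L[ℝ] ℝ).smulRight ξ) := by
    rw [sub_self]
    exact hφ.hasMFDerivAt_zero
  have h1 : HasMFDerivAt 𝓘(ℝ, V) 𝓘(ℝ, ℝ) (fun y => c y - c x) x (fderiv ℝ c x) :=
    (hc.hasFDerivAt.sub_const _).hasMFDerivAt
  exact HasMFDerivAt.comp (f := fun y => c y - c x) x h0 h1

variable {𝔞 : Submodule ℝ E}

/-- On commuting vectors the exponential of a sum is a product of one-parameter subgroups, and the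
`Ad` factors from the product rule act trivially. No formula for the differential of the exponential
map is needed. -/
theorem rightLogDeriv_lieExp_sum (h𝔞 : ∀ ξ ∈ 𝔞, ∀ η ∈ 𝔞, lieBracket G ξ η = 0)
    {ι : Type*} (s : Finset ι) {w : ι → E} (hw : ∀ i, w i ∈ 𝔞) {c : ι → V → ℝ} {x : V}
    (hc : ∀ i, DifferentiableAt ℝ (c i) x) :
    MDifferentiableAt 𝓘(ℝ, V) 𝓘(ℝ, E) (fun y => lieExp G (∑ i ∈ s, c i y • w i)) x ∧
      rightLogDeriv (fun y => lieExp G (∑ i ∈ s, c i y • w i)) x =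
        ∑ i ∈ s, (fderiv ℝ (c i) x).smulRight (w i) := by
  classical
  induction s using Finset.induction_on with
  | empty =>
    simp only [Finset.sum_empty]
    exact ⟨mdifferentiableAt_const, rightLogDeriv_const _ _⟩
  | insert i s hi ih =>
    have hsum : ∀ y, (∑ j ∈ s, c j y • w j) ∈ 𝔞 := fun y =>
      𝔞.sum_mem fun j _ => 𝔞.smul_mem _ (hw j)
    have hf : (fun y => lieExp G (∑ j ∈ insert i s, c j y • w j)) =
        fun y => lieExp G (c i y • w i) * lieExp G (∑ j ∈ s, c j y • w j) := by
      ext y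
      rw [Finset.sum_insert hi, lieExp_add (h𝔞 _ (𝔞.smul_mem _ (hw i)) _ (hsum y))]
    rw [hf]
    refine ⟨mdifferentiableAt_group_mul (mdifferentiableAt_lieExp_smul (hc i) _) ih.1, ?_⟩
    rw [rightLogDeriv_mul (mdifferentiableAt_lieExp_smul (hc i) _) ih.1, ih.2,
      rightLogDeriv_lieExp_smul (hc i), Finset.sum_insert hi]
    congr 1
    ext z
    rw [ContinuousLinearMap.comp_apply]
    refine Ad_lieExp (h𝔞 _ (𝔞.smul_mem _ (hw i)) _ ?_)
    rw [sum_apply]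
    exact 𝔞.sum_mem fun j _ => 𝔞.smul_mem _ (hw j)

/-- On a commutative subspace `𝔞`, the logarithmic derivative of `e^μ` is `δμ`. -/
theorem rightLogDeriv_lieExp [FiniteDimensional ℝ E]
    (h𝔞 : ∀ ξ ∈ 𝔞, ∀ η ∈ 𝔞, lieBracket G ξ η = 0) {μ : V → E} {x : V}
    (hμ : DifferentiableAt ℝ μ x) (hmem : ∀ y, μ y ∈ 𝔞) :
    MDifferentiableAt 𝓘(ℝ, V) 𝓘(ℝ, E) (fun y => lieExp G (μ y)) x ∧
      rightLogDeriv (fun y => lieExp G (μ y)) x = fderiv ℝ μ x := by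
  -- A linear projection onto `𝔞` extends its coordinates to functionals on `E`, so the coefficients
  -- of `μ` are differentiable.
  obtain ⟨π, hπ⟩ := 𝔞.subtype.exists_leftInverse_of_injective (by simp)
  let b := Module.finBasis ℝ 𝔞
  let L : Fin (Module.finrank ℝ 𝔞) → E →L[ℝ] ℝ := fun i =>
    LinearMap.toContinuousLinearMap (b.coord i ∘ₗ π)
  have hπ' : ∀ ξ : 𝔞, π ξ = ξ := fun ξ => LinearMap.congr_fun hπ ξ
  have hsum : μ = fun y => ∑ i, L i (μ y) • (b i : E) := by
    ext y
    have h := congrArg (fun ξ : 𝔞 => (ξ : E)) (b.sum_repr ⟨μ y, hmem y⟩)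
    simp only [Submodule.coe_sum, Submodule.coe_smul] at h
    refine h.symm.trans (Finset.sum_congr rfl fun i _ => ?_)
    congr 1
    exact congrArg (fun ξ => b.repr ξ i) (hπ' ⟨μ y, hmem y⟩).symm
  have hc : ∀ i, DifferentiableAt ℝ (fun y => L i (μ y)) x := fun i =>
    (L i).differentiableAt.comp x hμ
  have h := rightLogDeriv_lieExp_sum h𝔞 Finset.univ (w := fun i => (b i : E))
    (fun i => (b i).2) hc
  simp only [← congrFun hsum _] at h
  refine ⟨h.1, h.2.trans ?_⟩
  conv_rhs => rw [hsum]
  rw [fderiv_fun_sum fun i _ => (hc i).smul_const _]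
  exact Finset.sum_congr rfl fun i _ => (fderiv_smul_const (hc i) _).symm

end CommutingSubgroups

/-! ### The cocycle `jPart` on the gauge group -/

section GaugeGroupAlgebra

variable {E : Type*} [NormedAddCommGroup E] [NormedSpace ℝ E]
  {G : Type*} [TopologicalSpace G] [ChartedSpace E G] [Group G] [LieGroup 𝓘(ℝ, E) ∞ G]

theorem grp_mul (h h' : GaugeGroup E G) : grp (h * h') = grp h * grp h' := rfl

theorem grp_inv (h : GaugeGroup E G) : grp h⁻¹ = (grp h)⁻¹ := rfl

theorem Ad_mul_apply (g h : G) (ξ : E) : Ad (g * h) ξ = Ad g (Ad h ξ : E) := by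
  rw [Ad_mul]
  rfl

omit [LieGroup 𝓘(ℝ, E) ∞ G] in
theorem Ad_one_apply (ξ : E) : Ad (1 : G) ξ = ξ := by
  rw [Ad_one]
  rfl

/-- The twisted cocycle identity, from which the formulas for inverses, conjugates and commutators
follow. -/
theorem jPart_mul (h h' : GaugeGroup E G) (ξ : E) :
    jPart (h * h') ξ = jPart h (Ad (grp h') ξ) + jPart h' ξ := by
  have e : vec (h * h') = vec h + AdStar (grp h)⁻¹ (vec h') := rfl
  simp only [jPart, grp_mul, e, AdStar, neg_apply, ContinuousLinearMap.comp_apply,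
    add_apply]
  rw [← Ad_mul_apply (grp h)⁻¹, inv_mul_cancel_left, Ad_mul_apply]
  ring

theorem jPart_one (ξ : E) : jPart (1 : GaugeGroup E G) ξ = 0 := by
  have e : vec (1 : GaugeGroup E G) = 0 := rfl
  simp [jPart, e, AdStar]

theorem jPart_inv (h : GaugeGroup E G) (ξ : E) :
    jPart h⁻¹ ξ = -jPart h (Ad (grp h)⁻¹ ξ) := by
  have e := jPart_mul h h⁻¹ ξ
  rw [mul_inv_cancel, jPart_one, grp_inv] at e
  linarith

/-- The component `j` of a conjugate. -/
theorem jPart_conj (X h : GaugeGroup E G) (ζ : E) :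
    jPart (X * h * X⁻¹) (Ad (grp X) ζ) = jPart h ζ + jPart X (Ad (grp h) ζ - ζ) := by
  rw [jPart_mul, jPart_mul, jPart_inv, grp_inv, ← Ad_mul_apply (grp X)⁻¹, inv_mul_cancel,
    Ad_one_apply, map_sub]
  ring

theorem AdStar_vec (h : GaugeGroup E G) : AdStar (grp h) (vec h) = -jPart h := by
  rw [jPart, neg_neg]

/-- The group elements on the right are those in the handle terms of `Θ`; this is why a handle
changes by an increment along `[B, A⁻¹]`. -/
theorem jPart_commutator (A B : GaugeGroup E G) (ξ : E) :
    jPart ⁅B, A⁻¹⁆ ξ = jPart A ξ - jPart A (Ad ((grp A)⁻¹ * (grp B)⁻¹ * grp A) ξ)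
      + (jPart B (Ad ((grp A)⁻¹ * (grp B)⁻¹ * grp A) ξ) - jPart B (Ad ((grp B)⁻¹ * grp A) ξ)) := by
  rw [commutatorElement_def, inv_inv]
  simp only [jPart_mul, jPart_inv, grp_mul, grp_inv, ← Ad_mul_apply, mul_assoc]
  ring

end GaugeGroupAlgebra

/-! ### Ordered products and telescoping sums -/

section DescProd

theorem descProd_zero {M : Type*} [Monoid M] {n : ℕ} (f : Fin n → M) : descProd f 0 = 1 := by
  simp [descProd]

theorem descProd_succ {M : Type*} [Monoid M] {n : ℕ} (f : Fin n → M) (i : Fin n) :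
    descProd f (i + 1) = f i * descProd f i := by
  have h : (i : ℕ) < (List.ofFn f).length := by simp
  rw [descProd, ← List.take_concat_get' _ _ h]
  simp [descProd]

theorem descProd_conj {M : Type*} [Group M] {n : ℕ} (q : M) (f : Fin n → M) (i : ℕ) :
    descProd (fun l => q * f l * q⁻¹) i = q * descProd f i * q⁻¹ :=
  (map_descProd (MulAut.conj q) f i).symm

theorem sum_fin_succ_sub (f : ℕ → ℝ) (n : ℕ) :
    ∑ i : Fin n, (f (i + 1) - f i) = f n - f 0 := by
  rw [Fin.sum_univ_eq_sum_range (fun i => f (i + 1) - f i), Finset.sum_range_sub]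

end DescProd

/-! ### Change of the puncture and handle terms under a gauge transformation -/

section GaugeVariation

variable {E : Type*} [NormedAddCommGroup E] [NormedSpace ℝ E]
  {G : Type*} [TopologicalSpace G] [ChartedSpace E G] [Group G] [LieGroup 𝓘(ℝ, E) ∞ G]
  {V : Type*} [NormedAddCommGroup V] [NormedSpace ℝ V]

theorem mdifferentiableAt_descProd {n : ℕ} {f : V → Fin n → G} {x : V}
    (hf : ∀ l, MDifferentiableAt 𝓘(ℝ, V) 𝓘(ℝ, E) (fun y => f y l) x) {i : ℕ} (hi : i ≤ n) :
    MDifferentiableAt 𝓘(ℝ, V) 𝓘(ℝ, E) (fun y => descProd (f y) i) x := by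
  induction i with
  | zero =>
    simp only [descProd_zero]
    exact mdifferentiableAt_const
  | succ i ih =>
    have h : (fun y => descProd (f y) (i + 1)) =
        fun y => f y ⟨i, hi⟩ * descProd (f y) i := funext fun y => descProd_succ (f y) ⟨i, hi⟩
    rw [h]
    exact mdifferentiableAt_group_mul (hf _) (ih (by omega))

theorem rightLogDeriv_mul_apply {u v : V → G} {x : V}
    (hu : MDifferentiableAt 𝓘(ℝ, V) 𝓘(ℝ, E) u x) (hv : MDifferentiableAt 𝓘(ℝ, V) 𝓘(ℝ, E) v x)
    (z : V) : (rightLogDeriv (fun y => u y * v y) x z : E) =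
      rightLogDeriv u x z + Ad (u x) (rightLogDeriv v x z : E) := by
  rw [rightLogDeriv_mul hu hv]
  rfl

theorem rightLogDeriv_conj_apply {u v : V → G} {x : V}
    (hu : MDifferentiableAt 𝓘(ℝ, V) 𝓘(ℝ, E) u x) (hv : MDifferentiableAt 𝓘(ℝ, V) 𝓘(ℝ, E) v x)
    (z : V) : (rightLogDeriv (fun y => u y * v y * (u y)⁻¹) x z : E) =
      rightLogDeriv u x z + Ad (u x) (rightLogDeriv v x z : E)
        - Ad (u x * v x * (u x)⁻¹) (rightLogDeriv u x z : E) := by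
  have h := DFunLike.congr_fun (rightLogDeriv_inv hu) z
  rw [ContinuousLinearMap.comp_apply, neg_apply] at h
  have h' : (rightLogDeriv (fun y => (u y)⁻¹) x z : E) =
      -Ad (u x)⁻¹ (rightLogDeriv u x z : E) := by
    rw [← map_neg, ← h, ← Ad_mul_apply, inv_mul_cancel, Ad_one_apply]
  rw [rightLogDeriv_mul_apply (mdifferentiableAt_group_mul hu hv) (mdifferentiableAt_group_inv hu),
    rightLogDeriv_mul_apply hu hv, h', map_neg, ← Ad_mul_apply, sub_eq_add_neg]

/-- The variation `R(u) - Ad(u) lam` of `u` under the infinitesimal conjugation by `lam`. -/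
def twistedDeriv (lam : E) (u : V → G) (x z : V) : E :=
  rightLogDeriv u x z - Ad (u x) lam

/-- The twist sits only on the rightmost factor, so the left factor contributes its plain
logarithmic derivative. -/
theorem twistedDeriv_mul {u v : V → G} {x : V} (lam : E)
    (hu : MDifferentiableAt 𝓘(ℝ, V) 𝓘(ℝ, E) u x) (hv : MDifferentiableAt 𝓘(ℝ, V) 𝓘(ℝ, E) v x)
    (z : V) : twistedDeriv lam (fun y => u y * v y) x z =
      rightLogDeriv u x z + Ad (u x) (twistedDeriv lam v x z) := by
  rw [twistedDeriv, rightLogDeriv_mul_apply hu hv, twistedDeriv, map_sub, Ad_mul_apply]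
  abel

variable {q : V → G} {x z : V} {lam : E}

theorem rightLogDeriv_gauge_mul {v : V → G} (hq : MDifferentiableAt 𝓘(ℝ, V) 𝓘(ℝ, E) q x)
    (hv : MDifferentiableAt 𝓘(ℝ, V) 𝓘(ℝ, E) v x)
    (hlam : (rightLogDeriv q x z : E) = Ad (q x) lam) :
    (rightLogDeriv (fun y => q y * v y) x z : E) = Ad (q x) (lam + rightLogDeriv v x z) := by
  rw [rightLogDeriv_mul_apply hq hv, hlam, map_add]

/-- In differences of such terms `lam` cancels, and the common `Ad (q x)` is absorbed by
`jPart_conj`. -/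
theorem rightLogDeriv_gauge_conj {u : V → G} (hq : MDifferentiableAt 𝓘(ℝ, V) 𝓘(ℝ, E) q x)
    (hu : MDifferentiableAt 𝓘(ℝ, V) 𝓘(ℝ, E) u x)
    (hlam : (rightLogDeriv q x z : E) = Ad (q x) lam) :
    (rightLogDeriv (fun y => q y * u y * (q y)⁻¹) x z : E) =
      Ad (q x) (lam + twistedDeriv lam u x z) := by
  rw [rightLogDeriv_conj_apply hq hu, hlam, ← Ad_mul_apply, inv_mul_cancel_right, Ad_mul_apply,
    twistedDeriv, map_add, map_sub]
  abel

/-- Here `p` is the partial product before the puncture and `u * p` the one after it. The hypothesis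
`huv` is the derivative of a conjugate `u = v C v⁻¹` of a constant `C`. By the cocycle identity the
last term is an increment of `jPart` of the partial product, so the whole correction telescopes. -/
theorem variation_puncture {X m : GaugeGroup E G} {u v p : V → G}
    (hX : grp X = q x) (hm : grp m = u x)
    (hq : MDifferentiableAt 𝓘(ℝ, V) 𝓘(ℝ, E) q x) (hu : MDifferentiableAt 𝓘(ℝ, V) 𝓘(ℝ, E) u x)
    (hv : MDifferentiableAt 𝓘(ℝ, V) 𝓘(ℝ, E) v x) (hp : MDifferentiableAt 𝓘(ℝ, V) 𝓘(ℝ, E) p x)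
    (hlam : (rightLogDeriv q x z : E) = Ad (q x) lam)
    (huv : (rightLogDeriv u x z : E) = rightLogDeriv v x z - Ad (u x) (rightLogDeriv v x z : E)) :
    jPart (X * m * X⁻¹) ((rightLogDeriv (fun y => q y * p y * (q y)⁻¹) x z : E)
        - rightLogDeriv (fun y => q y * v y) x z) =
      jPart m ((rightLogDeriv p x z : E) - rightLogDeriv v x z)
        + (jPart X (twistedDeriv lam (fun y => u y * p y) x z)
          - jPart X (twistedDeriv lam p x z) - jPart m (Ad (p x) lam)) := by
  rw [rightLogDeriv_gauge_conj hq hp hlam, rightLogDeriv_gauge_mul hq hv hlam, ← map_sub, ← hX,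
    jPart_conj, twistedDeriv_mul _ hu hp, huv, hm]
  simp only [twistedDeriv, map_sub, map_add]
  ring

theorem variation_handle {X A B : GaugeGroup E G} {a b p : V → G}
    (hX : grp X = q x) (hA : grp A = a x) (hB : grp B = b x)
    (hq : MDifferentiableAt 𝓘(ℝ, V) 𝓘(ℝ, E) q x) (ha : MDifferentiableAt 𝓘(ℝ, V) 𝓘(ℝ, E) a x)
    (hb : MDifferentiableAt 𝓘(ℝ, V) 𝓘(ℝ, E) b x) (hp : MDifferentiableAt 𝓘(ℝ, V) 𝓘(ℝ, E) p x)
    (hlam : (rightLogDeriv q x z : E) = Ad (q x) lam) :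
    jPart (X * A * X⁻¹) ((rightLogDeriv (fun y => q y * p y * (q y)⁻¹) x z : E)
        - rightLogDeriv (fun y => q y * ((a y)⁻¹ * (b y)⁻¹ * a y * p y) * (q y)⁻¹) x z)
      + jPart (X * B * X⁻¹)
        ((rightLogDeriv (fun y => q y * ((a y)⁻¹ * (b y)⁻¹ * a y * p y) * (q y)⁻¹) x z : E)
        - rightLogDeriv (fun y => q y * ((b y)⁻¹ * a y * p y) * (q y)⁻¹) x z) =
      jPart A ((rightLogDeriv p x z : E)
        - rightLogDeriv (fun y => (a y)⁻¹ * (b y)⁻¹ * a y * p y) x z)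
      + jPart B ((rightLogDeriv (fun y => (a y)⁻¹ * (b y)⁻¹ * a y * p y) x z : E)
        - rightLogDeriv (fun y => (b y)⁻¹ * a y * p y) x z)
      + (jPart X (twistedDeriv lam (fun y => ⁅b y, (a y)⁻¹⁆ * p y) x z)
          - jPart X (twistedDeriv lam p x z) - jPart ⁅B, A⁻¹⁆ (Ad (p x) lam)) := by
  have ha' := mdifferentiableAt_group_inv ha
  have hb' := mdifferentiableAt_group_inv hb
  have hW := mdifferentiableAt_group_mul (mdifferentiableAt_group_mul hb' ha) hp
  have hT := mdifferentiableAt_group_mul (mdifferentiableAt_group_mul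
    (mdifferentiableAt_group_mul ha' hb') ha) hp
  -- With `T = a⁻¹ b⁻¹ a p` and `W = b⁻¹ a p`, the relations `[b, a⁻¹] p = b T`, `W = a T` and `a p
  -- = b W` express all twisted derivatives through one another; the goal is linear in them.
  have e1 : (fun y => ⁅b y, (a y)⁻¹⁆ * p y) =
      fun y => b y * ((a y)⁻¹ * (b y)⁻¹ * a y * p y) := by
    ext y
    rw [commutatorElement_def]
    group
  have e2 : (fun y => (b y)⁻¹ * a y * p y) =
      fun y => a y * ((a y)⁻¹ * (b y)⁻¹ * a y * p y) := by
    ext y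
    group
  have e3 : (fun y => a y * p y) = fun y => b y * ((b y)⁻¹ * a y * p y) := by
    ext y
    group
  have f1 := twistedDeriv_mul lam hb hT z
  have f2 := twistedDeriv_mul lam ha hT z
  have f3 := twistedDeriv_mul lam hb hW z
  have f4 := twistedDeriv_mul lam ha hp z
  rw [← e1] at f1
  rw [← e2] at f2
  rw [← e3, f4] at f3
  rw [rightLogDeriv_gauge_conj hq hp hlam, rightLogDeriv_gauge_conj hq hT hlam,
    rightLogDeriv_gauge_conj hq hW hlam, ← map_sub, ← map_sub, ← hX, jPart_conj, jPart_conj, f1,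
    jPart_commutator, ← Ad_mul_apply, ← Ad_mul_apply, hA, hB]
  have g1 := congrArg (jPart X) f2
  have g2 := congrArg (jPart X) f3
  simp only [add_sub_add_left_eq_sub, map_sub, map_add] at g1 g2 ⊢
  have d1 : ∀ (u : V → G) (j : StrongDual ℝ E), j (twistedDeriv lam u x z) =
    j (rightLogDeriv u x z : E) - j (Ad (u x) lam) := fun u j => by rw [twistedDeriv, map_sub]
  rw [d1 _ (jPart A), d1 _ (jPart A), d1 _ (jPart B), d1 _ (jPart B)]
  linarith

end GaugeVariation

/-! ### Gauge transformations of the extended phase space and invariance of the potential -/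

section PhaseSpaceVariation

variable {E : Type*} [NormedAddCommGroup E] [NormedSpace ℝ E]
  {G : Type*} [TopologicalSpace G] [ChartedSpace E G] [Group G] [LieGroup 𝓘(ℝ, E) ∞ G]
  {n g : ℕ} {𝔠 : Submodule ℝ (E × StrongDual ℝ E)} {orb : Fin n → E × StrongDual ℝ E}

namespace PhasePoint

/-- The simultaneous gauge transformation of all variables by `X ∈ G ⋉ 𝔤*`. -/
def conj (X : GaugeGroup E G) (p : PhasePoint E G n g 𝔠) : PhasePoint E G n g 𝔠 where
  gM i := X * p.gM i
  A j := X * p.A j * X⁻¹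
  B j := X * p.B j * X⁻¹
  gInf := X * p.gInf
  w := p.w
  μs := p.μs

variable (X : GaugeGroup E G) (p : PhasePoint E G n g 𝔠)

theorem conj_M (i : Fin n) : (p.conj X).M orb i = X * p.M orb i * X⁻¹ := by
  simp only [M, conj]
  group

theorem conj_KInv : (p.conj X).KInv orb = X * p.KInv orb * X⁻¹ := by
  have h : (fun j => ⁅(p.conj X).B j, ((p.conj X).A j)⁻¹⁆) =
      fun j => X * ⁅p.B j, (p.A j)⁻¹⁆ * X⁻¹ := by
    ext1 j
    simp only [conj, commutatorElement_def]
    group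
  rw [KInv, h, descProd_conj, funext (p.conj_M (orb := orb) X), descProd_conj, KInv]
  group

theorem grp_descProd {n : ℕ} (f : Fin n → GaugeGroup E G) (i : ℕ) :
    grp (descProd f i) = descProd (fun l => grp (f l)) i :=
  map_descProd (SemidirectProduct.rightHom (φ := coadjointAction E G)) f i

theorem uM_eq (i : ℕ) : p.uM orb i = grp (descProd (p.M orb) i) := (grp_descProd _ i).symm

theorem uHM_eq (i : ℕ) : p.uHM orb i =
    grp (descProd (fun j => ⁅p.B j, (p.A j)⁻¹⁆) i * descProd (p.M orb) n) := by
  rw [grp_mul, grp_descProd, uHM, uM_eq]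
  rfl

theorem uHM_eq_grp_KInv : p.uHM orb g = grp (p.KInv orb) := p.uHM_eq g

theorem conj_uM (i : ℕ) : (p.conj X).uM orb i = grp X * p.uM orb i * (grp X)⁻¹ := by
  rw [uM_eq, uM_eq, funext (p.conj_M (orb := orb) X), descProd_conj]
  rfl

theorem conj_uHM (i : ℕ) : (p.conj X).uHM orb i = grp X * p.uHM orb i * (grp X)⁻¹ := by
  have h : (fun j => ⁅grp ((p.conj X).B j), (grp ((p.conj X).A j))⁻¹⁆) =
      fun j => grp X * ⁅grp (p.B j), (grp (p.A j))⁻¹⁆ * (grp X)⁻¹ := by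
    ext1 j
    simp only [conj, commutatorElement_def, grp_mul, grp_inv]
    group
  rw [uHM, h, descProd_conj, conj_uM, uHM]
  group

theorem uM_zero : p.uM orb 0 = 1 := descProd_zero _

theorem uM_succ (i : Fin n) : p.uM orb (i + 1) = grp (p.M orb i) * p.uM orb i :=
  descProd_succ _ i

theorem uHM_zero : p.uHM orb 0 = p.uM orb n := by
  rw [uHM, descProd_zero, one_mul]

theorem uHM_succ (i : Fin g) :
    p.uHM orb (i + 1) = ⁅grp (p.B i), (grp (p.A i))⁻¹⁆ * p.uHM orb i := by
  rw [uHM, descProd_succ, mul_assoc, uHM]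

end PhasePoint

variable {V : Type*} [NormedAddCommGroup V] [NormedSpace ℝ V]

/-- Differentiability at `x` of the `G`-components of a family of points of the phase space. -/
structure DifferentiableFamilyAt (F : V → PhasePoint E G n g 𝔠) (x : V) : Prop where
  gM : ∀ i, MDifferentiableAt 𝓘(ℝ, V) 𝓘(ℝ, E) (fun y => grp ((F y).gM i)) x
  A : ∀ i, MDifferentiableAt 𝓘(ℝ, V) 𝓘(ℝ, E) (fun y => grp ((F y).A i)) x
  B : ∀ i, MDifferentiableAt 𝓘(ℝ, V) 𝓘(ℝ, E) (fun y => grp ((F y).B i)) x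
  gInf : MDifferentiableAt 𝓘(ℝ, V) 𝓘(ℝ, E) (fun y => grp (F y).gInf) x
  μs : DifferentiableAt ℝ (fun y => (F y).μs.1.1) x

namespace DifferentiableFamilyAt

variable {F : V → PhasePoint E G n g 𝔠} {x : V}

theorem M (hF : DifferentiableFamilyAt F x) (i : Fin n) :
    MDifferentiableAt 𝓘(ℝ, V) 𝓘(ℝ, E) (fun y => grp ((F y).M orb i)) x :=
  mdifferentiableAt_group_mul (mdifferentiableAt_group_mul (hF.gM i) mdifferentiableAt_const)
    (mdifferentiableAt_group_inv (hF.gM i))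

theorem uM (hF : DifferentiableFamilyAt F x) {i : ℕ} (hi : i ≤ n) :
    MDifferentiableAt 𝓘(ℝ, V) 𝓘(ℝ, E) (fun y => (F y).uM orb i) x :=
  mdifferentiableAt_descProd hF.M hi

theorem uHM (hF : DifferentiableFamilyAt F x) {i : ℕ} (hi : i ≤ g) :
    MDifferentiableAt 𝓘(ℝ, V) 𝓘(ℝ, E) (fun y => (F y).uHM orb i) x :=
  mdifferentiableAt_group_mul (mdifferentiableAt_descProd (fun j => by
    simp only [commutatorElement_def, inv_inv]
    exact mdifferentiableAt_group_mul (mdifferentiableAt_group_mul (mdifferentiableAt_group_mul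
      (hF.B j) (mdifferentiableAt_group_inv (hF.A j))) (mdifferentiableAt_group_inv (hF.B j)))
      (hF.A j)) hi) (hF.uM le_rfl)

theorem rightLogDeriv_M (hF : DifferentiableFamilyAt F x) (i : Fin n) (z : V) :
    (rightLogDeriv (fun y => grp ((F y).M orb i)) x z : E) =
      rightLogDeriv (fun y => grp ((F y).gM i)) x z
        - Ad (grp ((F x).M orb i)) (rightLogDeriv (fun y => grp ((F y).gM i)) x z : E) := by
  have h := rightLogDeriv_conj_apply (hF.gM i)
    (mdifferentiableAt_const (c := grp (expNeg (G := G) (orb i)))) z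
  rw [rightLogDeriv_const, zero_apply, map_zero, add_zero] at h
  exact h

end DifferentiableFamilyAt

/-- The corrections telescope through the partial products of `K⁻¹`, first over punctures and then
over handles, so only the two ends contribute. -/
theorem Theta_conj {F : V → PhasePoint E G n g 𝔠} {X : V → GaugeGroup E G} {x : V}
    (hF : DifferentiableFamilyAt F x)
    (hX : MDifferentiableAt 𝓘(ℝ, V) 𝓘(ℝ, E) (fun y => grp (X y)) x) {z : V} {lam : E}
    (hlam : (rightLogDeriv (fun y => grp (X y)) x z : E) = Ad (grp (X x)) lam) :
    Theta orb (fun y => (F y).conj (X y)) x z = Theta orb F x z +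
      (jPart (X x) (twistedDeriv lam (fun y => grp ((F y).KInv orb)) x z) + jPart (X x) lam
        - jPart ((F x).KInv orb) lam) := by
  set f : (V → G) → ℝ := fun u => jPart (X x) (twistedDeriv lam u x z) with hf
  have hM : ∀ i : Fin n, jPart (((F x).conj (X x)).M orb i)
      ((rightLogDeriv (fun y => ((F y).conj (X y)).uM orb i) x z : E)
        - rightLogDeriv (fun y => grp (((F y).conj (X y)).gM i)) x z) =
      jPart ((F x).M orb i) ((rightLogDeriv (fun y => (F y).uM orb i) x z : E)
        - rightLogDeriv (fun y => grp ((F y).gM i)) x z)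
      + ((f (fun y => (F y).uM orb (i + 1 : ℕ)) - jPart (descProd ((F x).M orb) (i + 1)) lam)
        - (f (fun y => (F y).uM orb i) - jPart (descProd ((F x).M orb) i) lam)) := by
    intro i
    have h := variation_puncture (X := X x) (m := (F x).M orb i) (q := fun y => grp (X y)) rfl rfl
      hX (hF.M i) (hF.gM i) (hF.uM (orb := orb) i.2.le) hlam (hF.rightLogDeriv_M (orb := orb) i z)
    simp only [PhasePoint.conj_M, PhasePoint.conj_uM, PhasePoint.uM_succ, descProd_succ]
    refine h.trans ?_
    rw [jPart_mul ((F x).M orb i), ← PhasePoint.uM_eq]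
    ring
  have hH : ∀ i : Fin g, jPart (((F x).conj (X x)).A i)
      ((rightLogDeriv (fun y => ((F y).conj (X y)).uHM orb i) x z : E)
        - rightLogDeriv (fun y => (grp (((F y).conj (X y)).A i))⁻¹
            * (grp (((F y).conj (X y)).B i))⁻¹ * grp (((F y).conj (X y)).A i)
            * ((F y).conj (X y)).uHM orb i) x z)
      + jPart (((F x).conj (X x)).B i)
      ((rightLogDeriv (fun y => (grp (((F y).conj (X y)).A i))⁻¹
            * (grp (((F y).conj (X y)).B i))⁻¹ * grp (((F y).conj (X y)).A i)
            * ((F y).conj (X y)).uHM orb i) x z : E)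
        - rightLogDeriv (fun y => (grp (((F y).conj (X y)).B i))⁻¹
            * grp (((F y).conj (X y)).A i) * ((F y).conj (X y)).uHM orb i) x z) =
      (jPart ((F x).A i) ((rightLogDeriv (fun y => (F y).uHM orb i) x z : E)
        - rightLogDeriv (fun y => (grp ((F y).A i))⁻¹ * (grp ((F y).B i))⁻¹ * grp ((F y).A i)
            * (F y).uHM orb i) x z)
      + jPart ((F x).B i) ((rightLogDeriv (fun y => (grp ((F y).A i))⁻¹ * (grp ((F y).B i))⁻¹
            * grp ((F y).A i) * (F y).uHM orb i) x z : E)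
        - rightLogDeriv (fun y => (grp ((F y).B i))⁻¹ * grp ((F y).A i)
            * (F y).uHM orb i) x z))
      + ((f (fun y => (F y).uHM orb (i + 1 : ℕ))
          - jPart (descProd (fun j => ⁅(F x).B j, ((F x).A j)⁻¹⁆) (i + 1)
            * descProd ((F x).M orb) n) lam)
        - (f (fun y => (F y).uHM orb i)
          - jPart (descProd (fun j => ⁅(F x).B j, ((F x).A j)⁻¹⁆) i
            * descProd ((F x).M orb) n) lam)) := by
    intro i
    have h := variation_handle (X := X x) (q := fun y => grp (X y)) (A := (F x).A i)
      (B := (F x).B i) rfl rfl rfl hX (hF.A i) (hF.B i) (hF.uHM (orb := orb) i.2.le) hlam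
    have e1 : (fun y => (grp (((F y).conj (X y)).A i))⁻¹
            * (grp (((F y).conj (X y)).B i))⁻¹ * grp (((F y).conj (X y)).A i)
            * ((F y).conj (X y)).uHM orb i) =
        fun y => grp (X y) * ((grp ((F y).A i))⁻¹ * (grp ((F y).B i))⁻¹ * grp ((F y).A i)
            * (F y).uHM orb i) * (grp (X y))⁻¹ := by
      ext1 y
      rw [PhasePoint.conj_uHM]
      simp only [PhasePoint.conj, grp_mul, grp_inv]
      group
    have e2 : (fun y => (grp (((F y).conj (X y)).B i))⁻¹ * grp (((F y).conj (X y)).A i)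
            * ((F y).conj (X y)).uHM orb i) =
        fun y => grp (X y) * ((grp ((F y).B i))⁻¹ * grp ((F y).A i)
            * (F y).uHM orb i) * (grp (X y))⁻¹ := by
      ext1 y
      rw [PhasePoint.conj_uHM]
      simp only [PhasePoint.conj, grp_mul, grp_inv]
      group
    rw [e1, e2]
    simp only [PhasePoint.conj_uHM, PhasePoint.uHM_succ, descProd_succ]
    refine h.trans ?_
    rw [mul_assoc ⁅(F x).B i, ((F x).A i)⁻¹⁆, jPart_mul ⁅(F x).B i, ((F x).A i)⁻¹⁆,
      ← PhasePoint.uHM_eq]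
    ring
  have hMsum := sum_fin_succ_sub (fun i => f (fun y => (F y).uM orb i)
    - jPart (descProd ((F x).M orb) i) lam) n
  have hHsum := sum_fin_succ_sub (fun i => f (fun y => (F y).uHM orb i)
    - jPart (descProd (fun j => ⁅(F x).B j, ((F x).A j)⁻¹⁆) i * descProd ((F x).M orb) n) lam) g
  -- For the empty product the logarithmic derivative vanishes and only the twist survives.
  have h1 : f (fun y => (F y).uM orb 0) = -jPart (X x) lam := by
    simp only [PhasePoint.uM_zero, hf, twistedDeriv, rightLogDeriv_const, Ad_one_apply]
    simp
  -- The handle sum starts where the puncture sum ends and finishes at `KInv`.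
  simp only [PhasePoint.uHM_zero, PhasePoint.uHM_eq_grp_KInv, descProd_zero, one_mul, jPart_one,
    h1] at hMsum hHsum
  have hK : descProd (fun j => ⁅(F x).B j, ((F x).A j)⁻¹⁆) g * descProd ((F x).M orb) n =
    (F x).KInv orb := rfl
  rw [hK] at hHsum
  simp only [Theta, add_apply, sum_apply, ContinuousLinearMap.comp_apply, sub_apply]
  have hM' := Finset.sum_congr (rfl : Finset.univ = Finset.univ) fun i _ => hM i
  have hH' := Finset.sum_congr (rfl : Finset.univ = Finset.univ) fun i _ => hH i
  simp only [Finset.sum_add_distrib, hMsum, hHsum] at hM' hH'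
  linarith

/-- The potential of the two-form is invariant under parameter-dependent gauge transformations. -/
theorem potential_conj [FiniteDimensional ℝ E] [T2Space G] (h𝔠 : IsAbelianSubalgebra G 𝔠)
    {F : V → PhasePoint E G n g 𝔠} {X : V → GaugeGroup E G} {x : V}
    (hF : DifferentiableFamilyAt F x) (hK : ∀ y, (F y).OnConstraintSurface orb)
    (hX : MDifferentiableAt 𝓘(ℝ, V) 𝓘(ℝ, E) (fun y => grp (X y)) x) :
    potential orb (fun y => (F y).conj (X y)) x = potential orb F x := by
  have hE : CompleteSpace E := FiniteDimensional.complete ℝ E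
  ext z
  -- `lam` is the left logarithmic derivative `q⁻¹ δq` of the `G`-component of `X`.
  set lam : E := Ad (grp (X x))⁻¹ (rightLogDeriv (fun y => grp (X y)) x z : E) with hl
  have hlam : (rightLogDeriv (fun y => grp (X y)) x z : E) = Ad (grp (X x)) lam := by
    rw [hl, ← Ad_mul_apply, mul_inv_cancel, Ad_one_apply]
  have h𝔞 : ∀ ξ ∈ 𝔠.map (LinearMap.fst ℝ E (StrongDual ℝ E)),
      ∀ η ∈ 𝔠.map (LinearMap.fst ℝ E (StrongDual ℝ E)), lieBracket G ξ η = 0 := by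
    rintro _ ⟨ξ, hξ, rfl⟩ _ ⟨η, hη, rfl⟩
    exact (h𝔠 ξ hξ η hη).1
  have hexp := rightLogDeriv_lieExp (G := G) h𝔞 (μ := fun y => -(F y).μs.1.1) hF.μs.fun_neg
    (fun y => neg_mem ⟨_, (F y).μs.2, rfl⟩)
  rw [fderiv_fun_neg] at hexp
  -- The logarithmic derivative of the constraint, which is therefore needed for a whole family and
  -- not just at `x`.
  have hu : (rightLogDeriv (fun y => grp ((F y).KInv orb)) x z : E) =
      rightLogDeriv (fun y => grp (F y).gInf) x z
        - Ad (grp (F x).gInf) (fderiv ℝ (fun y => (F y).μs.1.1) x z)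
        - Ad (grp ((F x).KInv orb)) (rightLogDeriv (fun y => grp (F y).gInf) x z : E) := by
    have e : (fun y => grp ((F y).KInv orb)) = fun y => grp (F y).gInf
        * lieExp G (-(F y).μs.1.1) * (grp (F y).gInf)⁻¹ := funext fun y => congrArg grp (hK y)
    have h := rightLogDeriv_conj_apply hF.gInf hexp.1 z
    rw [hexp.2, ← e, neg_apply, map_neg, ← congrFun e x, ← sub_eq_add_neg] at h
    exact h
  have hv : (rightLogDeriv (fun y => grp ((F y).conj (X y)).gInf) x z : E) =
      Ad (grp (X x)) (lam + rightLogDeriv (fun y => grp (F y).gInf) x z) :=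
    rightLogDeriv_gauge_mul hX hF.gInf hlam
  have hj := jPart_mul (X x) (F x).gInf (fderiv ℝ (fun y => (F y).μs.1.1) x z)
  simp only [potential, add_apply, sub_apply, ContinuousLinearMap.comp_apply, AdStar_vec,
    Theta_conj hF hX hlam, PhasePoint.conj_KInv, hv, jPart_conj, neg_apply]
  simp only [PhasePoint.conj, hj]
  -- After the `lam` terms cancel, what is left is the pairing of `hu` with `j_X`; its `δμ` part
  -- matches the change `hj` of the last term of the potential.
  have hz := congrArg (jPart (X x)) hu
  simp only [twistedDeriv, map_sub, map_add] at hz ⊢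
  linarith

end PhaseSpaceVariation

/-! ### Change of basepoint as a gauge transformation -/

section Connection

variable {E : Type*} [NormedAddCommGroup E] [NormedSpace ℝ E]
  {G : Type*} [TopologicalSpace G] [ChartedSpace E G] [Group G] [LieGroup 𝓘(ℝ, E) ∞ G]
  {S : Type*} [TopologicalSpace S] {n g : ℕ} {P : Punctures S n}
  {orb : Fin n → E × StrongDual ℝ E} {𝔠 : Submodule ℝ (E × StrongDual ℝ E)}

/-- The order is reversed because composition in `SingleObj` puts the later morphism on the left. -/
theorem parallelTransport_trans (ρ : FlatConnection E G S) {p q r : S} (c : Path p q)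
    (e : Path q r) :
    parallelTransport ρ (c.trans e) = parallelTransport ρ e * parallelTransport ρ c :=
  ρ.map_comp (X := .mk p) (Y := .mk q) (Z := .mk r) ⟦c⟧ ⟦e⟧

theorem parallelTransport_symm (ρ : FlatConnection E G S) {p q : S} (c : Path p q) :
    parallelTransport ρ c.symm = (parallelTransport ρ c)⁻¹ := by
  have key : ∀ {p q : FundamentalGroupoid S} (c : p ⟶ q),
      ρ.map c ≫ ρ.map (Groupoid.inv c) = 𝟙 _ := by
    intro p q c
    rw [← ρ.map_comp, Groupoid.comp_inv, ρ.map_id]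
  exact eq_inv_of_mul_eq_one_left (key (p := .mk p) (q := .mk q) ⟦c⟧)

/-- Loops transported along `c` have conjugated holonomy, while a tail preceded by `c⁻¹` multiplies
the frame coordinate by the transport on the left. -/
theorem GeneratorSystem.coords_changeBasepoint {p p' : S} (Γ : GeneratorSystem P g p)
    (c : Path p p') (Φ : PuncturedField (E := E) (G := G) P orb 𝔠) :
    (Γ.changeBasepoint c).coords Φ = (Γ.coords Φ).conj (parallelTransport Φ.conn c) := by
  simp only [GeneratorSystem.coords, GeneratorSystem.changeBasepoint, PhasePoint.conj,
    holonomy_transport, parallelTransport_trans, parallelTransport_symm, mul_inv_rev, inv_inv,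
    mul_assoc]

theorem SmoothOn.mdifferentiableAt {V : Type*} [NormedAddCommGroup V] [NormedSpace ℝ V]
    {h : V → GaugeGroup E G} {U : Set V} (hh : SmoothOn h U) (hU : IsOpen U) {x : V} (hx : x ∈ U) :
    MDifferentiableAt 𝓘(ℝ, V) 𝓘(ℝ, E) (fun y => grp (h y)) x :=
  (hh.1.contMDiffAt (hU.mem_nhds hx)).mdifferentiableAt (by simp)

theorem SmoothFamilyOn.holonomy {V : Type*} [NormedAddCommGroup V] [NormedSpace ℝ V]
    {Φ : V → PuncturedField (E := E) (G := G) P orb 𝔠} {U : Set V} (hΦ : SmoothFamilyOn Φ U)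
    {p : S} (γ : FundamentalGroup S p) :
    SmoothOn (fun x => ChernSimons.holonomy (Φ x).conn γ) U := by
  obtain ⟨c, hc⟩ := Quotient.exists_rep γ
  subst hc
  exact hΦ.parallelTransport p p c

theorem SmoothFamilyOn.differentiableFamilyAt {V : Type*} [NormedAddCommGroup V] [NormedSpace ℝ V]
    {Φ : V → PuncturedField (E := E) (G := G) P orb 𝔠} {U : Set V} (hΦ : SmoothFamilyOn Φ U)
    (hU : IsOpen U) {x : V} (hx : x ∈ U) {p : S} (Γ : GeneratorSystem P g p) :
    DifferentiableFamilyAt (fun y => Γ.coords (Φ y)) x where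
  gM i := mdifferentiableAt_group_mul (mdifferentiableAt_group_inv
    ((hΦ.parallelTransport _ _ (Γ.tail i)).mdifferentiableAt hU hx))
    ((hΦ.frame i).mdifferentiableAt hU hx)
  A i := (hΦ.holonomy (Γ.a i)).mdifferentiableAt hU hx
  B i := (hΦ.holonomy (Γ.b i)).mdifferentiableAt hU hx
  gInf := mdifferentiableAt_group_mul (mdifferentiableAt_group_inv
    ((hΦ.parallelTransport _ _ Γ.tailInf).mdifferentiableAt hU hx))
    (hΦ.frameInf.mdifferentiableAt hU hx)
  μs := ((hΦ.μs.contDiffAt (hU.mem_nhds hx)).differentiableAt (by simp)).fst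

end Connection

end

end ChernSimons

/-! ### Independence of the basepoint -/

open ChernSimons
theorem mainTheorem4
    {E : Type*} [NormedAddCommGroup E] [NormedSpace ℝ E] [FiniteDimensional ℝ E]
    {G : Type*} [TopologicalSpace G] [ChartedSpace E G] [Group G] [LieGroup 𝓘(ℝ, E) ∞ G]
    [T2Space G]
    {S : Type*} [TopologicalSpace S] {n g : ℕ} (P : Punctures S n)
    (k : ℝ) (orb : Fin n → E × StrongDual ℝ E)
    (𝔠 : Submodule ℝ (E × StrongDual ℝ E)) (h𝔠 : IsAbelianSubalgebra G 𝔠)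
    {V : Type*} [NormedAddCommGroup V] [NormedSpace ℝ V] {U : Set V} (hU : IsOpen U)
    (Φ : V → PuncturedField (E := E) (G := G) P orb 𝔠) (hΦ : SmoothFamilyOn Φ U)
    {p p' : S} (Γ : GeneratorSystem P g p) (c : Path p p') :
    ∀ x ∈ U, twoForm k orb (fun y => Γ.coords (Φ y)) x =
      twoForm k orb (fun y => (Γ.changeBasepoint c).coords (Φ y)) x := by
  intro x hx
  rw [twoForm, twoForm]
  congr 1
  -- The exterior derivative depends only on the germ of the potential, so equality of the
  -- potentials near `x` suffices; openness of `U` provides the neighbourhood.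
  refine Filter.EventuallyEq.extDeriv_eq ?_
  filter_upwards [hU.mem_nhds hx] with y hy
  simp only [Γ.coords_changeBasepoint]
  rw [potential_conj h𝔠 (hΦ.differentiableFamilyAt hU hy Γ)
    (fun y => Γ.coords_onConstraintSurface (Φ y))
    ((hΦ.parallelTransport p p' c).mdifferentiableAt hU hy)]
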